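/- All graphs are finite and may have loops and parallel edges; a loop contributes $2$ to the degree of its node. A $\{1,3\}$-graph is a graph all of whose nodes have degree $1$ or $3$; nodes of degree $3$ are called internal. For a $\{1,3\}$-graph $G$ with edge set $E$ and set $I$ of internal nodes, let $\mathcal P_G\subset\mathbb R^E$ be the polytope of all $w$ such that, for every internal node $v$ with incident edges $a,b,c$ (a loop being listed twice), $$w_a\le w_b+w_c,\qquad w_b\le w_a+w_c,\qquad w_c\le w_a+w_b,\qquad w_a+w_b+w_c\le 1,$$ and $0\le w_e\le \tfrac12$ for every edge $e$ that alone is a component of $G$. Let $\mathcal Q_G\subset\mathbb R^E\times\mathbb R^I$ be the polytope of all $(w,z)$ such that, for every internal node $v$ with incident edges $a,b,c$, the same three triangle inequalities hold together with $w_a+w_b+w_c=2z_v$ and $z_v\le 1$, and $0\le w_e\le 1$ for every edge $e$ that alone is a component of $G$. For an integer $t\ge 0$ let $L^{\mathcal P}_G(t)=|t\mathcal P_G\cap\mathbb Z^E|$ and $L^{\mathcal Q}_G(t)=|t\mathcal Q_G\cap(\mathbb Z^E\times\mathbb Z^I)|$. A function $f$ on the nonnegative integers is a quasi-polynomial if for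 some $\alpha\ge1$ there are polynomials $f_0,\dots,f_{\alpha-1}$ with $f(t)=f_i(t)$ whenever $t\equiv i \pmod\alpha$; the least such $\alpha$ is its period. **Theorem.** Let $G$ be a connected $\{1,3\}$-graph. Then $L^{\mathcal P}_G$ is a quasi-polynomial; its period is at most $2$ if $G$ is a tree or a cubic graph (all nodes of degree $3$), and is exactly $4$ otherwise. Moreover, let $G$ be cubic with $n$ nodes and $m$ edges, let $k=m-n+1$ be its cyclomatic number, and let $N_G$ be the number of internally Eulerian subgraphs of $G$, that is, of sets of edges for which every internal node is incident to exactly zero or two of the edges (a loop counting twice). Then there are polynomials $p_0,p_1,p_2,p_3$ with $L^{\mathcal P}_G(t)=p_i(t)$ for all integers $t\ge 0$ with $t\equiv i\pmod 4$, and $q_0,q_1$ with $L^{\mathcal Q}_G(t)=q_i(t)$ for all integers $t\ge 0$ with $t\equiv i\pmod 2$, and for every real $t$ $$q_0(t)=N_G\,p_0(t)-(N_G-1)\Bigl(\tfrac t2+1\Bigr)^{k-1}=N_G\,p_2(t)-(N_G-1)\Bigl(\tfrac t2+1\Bigr)^{k-1}.$$ -/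

import Mathlib

open scoped Graph Pointwise

/-! Multigraphs (loops and parallel edges allowed) are Mathlib's `Graph α β`. -/

namespace Graph

variable {α β : Type*}

/-- The degree of a vertex; a loop counts twice. -/
noncomputable def degree (G : Graph α β) (v : α) : ℕ :=
  (G.incidenceSet v).ncard + (G.loopSet v).ncard

/-- A connected graph: nonempty, and any two vertices are joined by a walk. -/
def IsConnected (G : Graph α β) : Prop :=
  V(G).Nonempty ∧ ∀ x ∈ V(G), ∀ y ∈ V(G), Relation.ReflTransGen G.Adj x y

/-- No cycles. A cycle of length `n + 1 ≥ 1` consists of distinct vertices `x 0, …, x n` and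
distinct edges `e 0, …, e n`, where `e i` joins `x i` to `x (i + 1)` (indices cyclic).
A loop is a cycle of length 1, two parallel edges form a cycle of length 2. -/
def IsAcyclic (G : Graph α β) : Prop :=
  ∀ (n : ℕ) (x : Fin (n + 1) → α) (e : Fin (n + 1) → β),
    Function.Injective x → Function.Injective e → ¬ ∀ i, G.IsLink (e i) (x i) (x (i + 1))

/-- A tree. -/
def IsTree (G : Graph α β) : Prop := G.IsConnected ∧ G.IsAcyclic

/-- A cubic graph. -/
def IsCubic (G : Graph α β) : Prop := ∀ v ∈ V(G), G.degree v = 3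

/-- Every vertex has degree 1 or 3. -/
def IsOneThree (G : Graph α β) : Prop := ∀ v ∈ V(G), G.degree v = 1 ∨ G.degree v = 3

/-- The internal nodes: the vertices of degree 3. -/
def internalNodes (G : Graph α β) : Set α := {v | v ∈ V(G) ∧ G.degree v = 3}

/-- The cyclomatic number `m - n + 1`, for `m` edges and `n` vertices
(a connected finite graph has `n ≤ m + 1`, so nothing is truncated there). -/
noncomputable def cyclomaticNumber (G : Graph α β) : ℕ := E(G).ncard + 1 - V(G).ncard

/-- The number of internally Eulerian subgraphs (given by their edge sets `S`): every
internal node of `G` has degree 0 or 2 in the subgraph. -/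
noncomputable def numInternallyEulerian (G : Graph α β) : ℕ :=
  {S : Set β | S ⊆ E(G) ∧
    ∀ v ∈ G.internalNodes, (G.restrict S).degree v = 0 ∨ (G.restrict S).degree v = 2}.ncard

open Classical in
/-- `a, b, c` are the three edges at the vertex `v`, in some order, a loop at `v` being listed
twice. -/
def EdgesAt (G : Graph α β) (v : α) (a b c : E(G)) : Prop :=
  ∀ e : E(G), (if e = a then 1 else 0) + (if e = b then 1 else 0) + (if e = c then 1 else 0) =
    (if G.Inc e v then 1 else 0) + (if G.IsLoopAt e v then 1 else 0)

/-- The edge `e` alone is a component of `G`. -/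
def IsEdgeComponent (G : Graph α β) (e : E(G)) : Prop :=
  ∀ (f : β) (x : α), G.Inc e x → G.Inc f x → f = e

/-- The Liu–Osserman polytope `P_G` in `ℝ^E`. -/
def polytopeP (G : Graph α β) : Set (E(G) → ℝ) :=
  {w | (∀ v ∈ G.internalNodes, ∀ a b c : E(G), G.EdgesAt v a b c →
          w a ≤ w b + w c ∧ w b ≤ w a + w c ∧ w c ≤ w a + w b ∧ w a + w b + w c ≤ 1) ∧
        ∀ e : E(G), G.IsEdgeComponent e → 0 ≤ w e ∧ w e ≤ 1 / 2}

/-- The Liu–Osserman polytope `Q_G` in `ℝ^E × ℝ^I`, where `I` is the set of internal nodes. -/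
def polytopeQ (G : Graph α β) : Set (E(G) ⊕ G.internalNodes → ℝ) :=
  {y | (∀ v : G.internalNodes, ∀ a b c : E(G), G.EdgesAt v a b c →
          y (.inl a) ≤ y (.inl b) + y (.inl c) ∧
          y (.inl b) ≤ y (.inl a) + y (.inl c) ∧
          y (.inl c) ≤ y (.inl a) + y (.inl b) ∧
          y (.inl a) + y (.inl b) + y (.inl c) = 2 * y (.inr v) ∧
          y (.inr v) ≤ 1) ∧
        ∀ e : E(G), G.IsEdgeComponent e → 0 ≤ y (.inl e) ∧ y (.inl e) ≤ 1}

end Graph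

/-- The Ehrhart counting function: the number of integer points in the dilate `t P`. -/
noncomputable def ehrhart {ι : Type*} (P : Set (ι → ℝ)) (t : ℕ) : ℕ :=
  {z : ι → ℤ | (fun i => (z i : ℝ)) ∈ (t : ℝ) • P}.ncard

/-- The polynomials `p 0, …, p (n - 1)` represent `f` on the residue classes modulo `n`. -/
def IsConstituents {n : ℕ} (f : ℕ → ℕ) (p : Fin n → Polynomial ℝ) : Prop :=
  ∀ (t : ℕ) (i : Fin n), t % n = i → (f t : ℝ) = (p i).eval (t : ℝ)

/-- `f` is a quasi-polynomial whose period, the least possible number of constituents, is `n`. -/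
def HasPeriod (f : ℕ → ℕ) (n : ℕ) : Prop :=
  IsLeast {m : ℕ | 0 < m ∧ ∃ p : Fin m → Polynomial ℝ, IsConstituents f p} n

/-!
Up to a change of coordinates, the integer points of `t P_G` and of `t Q_G` are the edge labelings
of `G` that obey, at every internal node, the fusion rule at level `t` of `SO(3)` and of `SU(2)`.
By Verlinde's formula a fusion rule is diagonalised by its characters `χ_j`, indexed by the angles
`jπ / (t + 2)`, so on a connected graph the labelings are counted by
`∑ j, norm_j ^ (|E| - |V|) * leaf_j ^ l`, where `norm_j = ∑ a, χ_j a ^ 2`, `leaf_j = ∑ a, χ_j a` and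
`l` is the number of leaves. For `SU(2)` the norm is `(t + 2) / (2 sin² (jπ / (t + 2)))`, and power
sums of cosecants over these angles are polynomials in `t`, by a second order recurrence. The
characters of `SO(3)` do not distinguish the angles `x` and `π - x`. The only fixed angle `π / 2`
occurs for even `t`, and its summand has the factor `leaf_j`, which for even `t` vanishes at `π / 2`
unless `t / 2` is even: hence period `4` if there is a leaf and a cycle. Without leaves this summand
yields the correction term `(t / 2 + 1) ^ (k - 1)` between the two polytopes; the factor `N_G` there
is the same state sum for the group `ℤ / 2`.
-/

namespace LiuOsserman

open Finset
open scoped Real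

/-! ### Finite trigonometric sums -/

lemma two_mul_sin_half_mul_sum_cos (x : ℝ) (n : ℕ) :
    2 * Real.sin (x / 2) * ∑ a ∈ range n, Real.cos (a * x) =
      Real.sin ((n - 1 / 2) * x) + Real.sin (x / 2) := by
  induction n with
  | zero => simp [show -(2⁻¹ * x) = -(x / 2) by ring]
  | succ n ih =>
    rw [sum_range_succ, mul_add, ih, show ((n : ℝ) - 1 / 2) * x = n * x - x / 2 by ring,
      show (((n + 1 : ℕ) : ℝ) - 1 / 2) * x = n * x + x / 2 by push_cast; ring,
      Real.sin_add, Real.sin_sub]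
    ring

lemma sin_int_mul_pi_div_eq_zero_iff {n : ℕ} (hn : n ≠ 0) {k : ℤ} :
    Real.sin (k * π / n) = 0 ↔ (n : ℤ) ∣ k := by
  have hn' : (n : ℝ) ≠ 0 := Nat.cast_ne_zero.2 hn
  rw [Real.sin_eq_zero_iff]
  refine exists_congr fun m => ?_
  rw [eq_div_iff hn', mul_right_comm, mul_right_cancel_iff_of_pos Real.pi_pos, eq_comm, mul_comm]
  exact_mod_cast Iff.rfl

lemma sin_nat_mul_pi_div_pos {n j : ℕ} (hj : 0 < j) (hjn : j < n) : 0 < Real.sin (j * π / n) := by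
  have hn : (0 : ℝ) < n := by exact_mod_cast hj.trans hjn
  have : (0 : ℝ) < j := by exact_mod_cast hj
  have h : (j : ℝ) < n := by exact_mod_cast hjn
  refine Real.sin_pos_of_pos_of_lt_pi (by positivity) ?_
  rw [div_lt_iff₀ hn]
  nlinarith [Real.pi_pos]

lemma sum_range_cos_int_mul_pi_div {n : ℕ} (hn : n ≠ 0) (k : ℤ) :
    ∑ a ∈ range n, Real.cos (a * (k * π / n)) =
      (if (2 * n : ℤ) ∣ k then (n : ℝ) else 0) + (1 - (-1 : ℝ) ^ k) / 2 := by
  have hn' : (n : ℝ) ≠ 0 := Nat.cast_ne_zero.2 hn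
  split_ifs with hk
  · obtain ⟨m, rfl⟩ := hk
    have hcos (a : ℕ) : Real.cos (a * (((2 * n * m : ℤ) : ℝ) * π / n)) = 1 := by
      rw [← Real.cos_int_mul_two_pi (a * m)]
      congr 1
      push_cast
      field_simp
    have hsign : (-1 : ℝ) ^ (2 * n * m : ℤ) = 1 := by rw [mul_assoc, zpow_mul]; simp
    rw [sum_congr rfl fun a _ => hcos a, hsign]
    simp
  · have hsin : Real.sin (k * π / n / 2) ≠ 0 := by
      have := (sin_int_mul_pi_div_eq_zero_iff (n := 2 * n) (by omega)).not.2 (by exact_mod_cast hk)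
      rwa [show (k * π / (2 * n : ℕ) : ℝ) = k * π / n / 2 by push_cast; field_simp] at this
    have hsum := two_mul_sin_half_mul_sum_cos (k * π / n) n
    rw [show ((n : ℝ) - 1 / 2) * (k * π / n) = k * π - k * π / n / 2 by field_simp,
      Real.sin_int_mul_pi_sub] at hsum
    refine mul_left_cancel₀ (mul_ne_zero two_ne_zero hsin) (hsum.trans ?_)
    ring

lemma sum_range_sin_mul_sin (n : ℕ) (r s : ℤ) :
    ∑ j ∈ range n, Real.sin (r * (j * π / n)) * Real.sin (s * (j * π / n)) =
      n / 2 * ((if (2 * n : ℤ) ∣ r - s then 1 else 0) -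
        if (2 * n : ℤ) ∣ r + s then 1 else 0) := by
  obtain rfl | hn := eq_or_ne n 0
  · simp
  have hprod (j : ℕ) : Real.sin (r * (j * π / n)) * Real.sin (s * (j * π / n)) =
      (Real.cos (j * (((r - s : ℤ) : ℝ) * π / n)) -
        Real.cos (j * (((r + s : ℤ) : ℝ) * π / n))) / 2 := by
    rw [show (j * (((r - s : ℤ) : ℝ) * π / n) : ℝ) = r * (j * π / n) - s * (j * π / n) by
        push_cast; ring,
      show (j * (((r + s : ℤ) : ℝ) * π / n) : ℝ) = r * (j * π / n) + s * (j * π / n) by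
        push_cast; ring, Real.cos_sub, Real.cos_add]
    ring
  have hsign : (-1 : ℝ) ^ (r - s) = (-1) ^ (r + s) := by
    rw [show r + s = r - s + 2 * s by ring, zpow_add₀ (by norm_num), zpow_mul]
    simp
  simp only [hprod]
  rw [← sum_div, sum_sub_distrib, sum_range_cos_int_mul_pi_div hn,
    sum_range_cos_int_mul_pi_div hn, hsign]
  split_ifs <;> ring

lemma sin_mul_sin_eq_sum (p : ℕ) (q x : ℝ) :
    Real.sin (p * x) * Real.sin (q * x) =
      Real.sin x * ∑ i ∈ range p, Real.sin ((q - p + 1 + 2 * i) * x) := by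
  have telescope (m : ℕ) : Real.sin x * ∑ i ∈ range m, Real.sin ((q - p + 1 + 2 * i) * x) =
      (Real.cos ((q - p) * x) - Real.cos ((q - p + 2 * m) * x)) / 2 := by
    induction m with
    | zero => simp
    | succ m ih =>
      rw [sum_range_succ, mul_add, ih,
        show (q - p + 2 * m : ℝ) * x = (q - p + 1 + 2 * m) * x - x by ring,
        show (q - p + 2 * (m + 1 : ℕ) : ℝ) * x = (q - p + 1 + 2 * m) * x + x by push_cast; ring,
        Real.cos_sub, Real.cos_add]
      ring
  rw [telescope p, show (q - p) * x = q * x - p * x by ring,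
    show (q - p + 2 * p) * x = q * x + p * x by ring, Real.cos_sub, Real.cos_add]
  ring

lemma sum_Ico_one_eq_sum_range {M : Type*} [AddCommMonoid M] {f : ℕ → M} (hf : f 0 = 0) (n : ℕ) :
    ∑ j ∈ Ico 1 n, f j = ∑ j ∈ range n, f j := by
  obtain _ | n := n
  · simp
  · rw [sum_range_eq_add_Ico _ n.succ_pos, hf, zero_add]

/-- The character of the irreducible representation of dimension `p` of `SU(2)`, at the conjugacy
class of `diag(exp (ix), exp (-ix))`. Division by zero makes it vanish where `sin x = 0`. -/
noncomputable def sinChar (p : ℕ) (x : ℝ) : ℝ := Real.sin (p * x) / Real.sin x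

/-- The squared norm of the vector of the values `sinChar p (jπ / n)`, `0 < p < n`: the reciprocal
of the Plancherel weight of the class `jπ / n` in the fusion ring of `SU(2)` at level `n - 2`. -/
noncomputable def suNorm (n j : ℕ) : ℝ := n / (2 * Real.sin (j * π / n) ^ 2)

lemma suNorm_pos {n j : ℕ} (hj : 0 < j) (hjn : j < n) : 0 < suNorm n j := by
  have := sin_nat_mul_pi_div_pos hj hjn
  have : (0 : ℝ) < n := by exact_mod_cast hj.trans hjn
  unfold suNorm
  positivity

lemma sinChar_one {n j : ℕ} (hj : 0 < j) (hjn : j < n) : sinChar 1 (j * π / n) = 1 := by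
  rw [sinChar, Nat.cast_one, one_mul, div_self (sin_nat_mul_pi_div_pos hj hjn).ne']

lemma pi_sub_nat_mul_pi_div {n j : ℕ} (hj : j < n) : π - j * π / n = (n - j : ℕ) * π / n := by
  have : (n : ℝ) ≠ 0 := Nat.cast_ne_zero.2 (by omega)
  rw [Nat.cast_sub hj.le]
  field_simp

lemma sinChar_odd_pi_sub (a : ℕ) (x : ℝ) : sinChar (2 * a + 1) (π - x) = sinChar (2 * a + 1) x := by
  rw [sinChar, sinChar, mul_sub, Real.sin_nat_mul_pi_sub, Real.sin_pi_sub, pow_succ, pow_mul]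
  norm_num

lemma suNorm_sub {n j : ℕ} (hj : j < n) : suNorm n (n - j) = suNorm n j := by
  rw [suNorm, ← pi_sub_nat_mul_pi_div hj, Real.sin_pi_sub, suNorm]

lemma sum_sinChar_odd (K : ℕ) (x : ℝ) :
    ∑ a ∈ range K, sinChar (2 * a + 1) x = Real.sin (K * x) ^ 2 / Real.sin x ^ 2 := by
  have hsum := sin_mul_sin_eq_sum K K x
  simp only [sub_self, zero_add] at hsum
  simp only [sinChar, Nat.cast_add, Nat.cast_mul, Nat.cast_ofNat, Nat.cast_one]
  rw [← sum_div, sq (Real.sin (K * x)), hsum]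
  obtain hx | hx := eq_or_ne (Real.sin x) 0
  · simp [hx]
  · rw [sq, mul_div_mul_left _ _ hx]
    simp only [add_comm (1 : ℝ)]

/-! ### The fusion rules of `SU(2)` -/

lemma sum_sinChar_mul_sinChar {n i j : ℕ} (hi : 0 < i) (hin : i < n) (hj : 0 < j) (hjn : j < n) :
    ∑ a ∈ range (n - 1), sinChar (a + 1) (i * π / n) * sinChar (a + 1) (j * π / n) =
      if i = j then suNorm n i else 0 := by
  have hdvd : ((2 * n : ℤ) ∣ i - j) ↔ i = j := by
    refine ⟨fun h => ?_, fun h => by simp [h]⟩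
    have := Int.eq_zero_of_abs_lt_dvd h (by rw [abs_lt]; omega)
    omega
  have hndvd : ¬ (2 * n : ℤ) ∣ i + j := fun h => by have := Int.le_of_dvd (by omega) h; omega
  have horth := sum_range_sin_mul_sin n i j
  rw [if_neg hndvd, sub_zero, ← sum_Ico_one_eq_sum_range (by simp), sum_Ico_eq_sum_range] at horth
  have hterm (a : ℕ) : sinChar (a + 1) (i * π / n) * sinChar (a + 1) (j * π / n) =
      Real.sin ((i : ℤ) * ((1 + a : ℕ) * π / n)) * Real.sin ((j : ℤ) * ((1 + a : ℕ) * π / n)) /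
        (Real.sin (i * π / n) * Real.sin (j * π / n)) := by
    rw [sinChar, sinChar, div_mul_div_comm]
    congr 3 <;> push_cast <;> ring
  simp only [hterm, hdvd] at horth ⊢
  rw [← sum_div, horth]
  split_ifs with hij
  · subst hij
    rw [suNorm]
    ring
  · simp

lemma sum_range_ite_add_two_mul_eq {p q : ℕ} (hpq : p ≤ q) (m : ℕ) :
    ∑ i ∈ range p, (if q - p + 1 + 2 * i = m then (1 : ℝ) else 0) =
      if q < p + m ∧ m < p + q ∧ Odd (p + q + m) then 1 else 0 := by
  simp only [Nat.odd_iff]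
  split_ifs with h
  · rw [sum_eq_single_of_mem ((m + p - q - 1) / 2) (by rw [mem_range]; omega)
      fun b _ hb => if_neg (by omega)]
    exact if_pos (by omega)
  · exact sum_eq_zero fun i hi => if_neg (by rw [mem_range] at hi; omega)

lemma sinChar_mul_sinChar {p q : ℕ} (hpq : p ≤ q) {x : ℝ} (hx : Real.sin x ≠ 0) :
    sinChar p x * sinChar q x = ∑ i ∈ range p, sinChar (q - p + 1 + 2 * i) x := by
  simp only [sinChar]
  push_cast [Nat.cast_sub hpq]
  rw [div_mul_div_comm, sin_mul_sin_eq_sum, mul_div_mul_left _ _ hx, sum_div]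

lemma sum_inv_suNorm_mul_sinChar_mul_sinChar {n r s : ℕ} (hr : 0 < r) (hrn : r < 2 * n)
    (hs : 0 < s) (hsn : s < n) :
    ∑ j ∈ Ico 1 n, (suNorm n j)⁻¹ * (sinChar r (j * π / n) * sinChar s (j * π / n)) =
      (if r = s then 1 else 0) - if r = 2 * n - s then 1 else 0 := by
  have hn : (n : ℝ) ≠ 0 := Nat.cast_ne_zero.2 (by omega)
  have hterm (j : ℕ) (hj : j ∈ Ico 1 n) :
      (suNorm n j)⁻¹ * (sinChar r (j * π / n) * sinChar s (j * π / n)) =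
        2 / n * (Real.sin ((r : ℤ) * (j * π / n)) * Real.sin ((s : ℤ) * (j * π / n))) := by
    rw [mem_Ico] at hj
    have hsin := (sin_nat_mul_pi_div_pos hj.1 hj.2).ne'
    rw [sinChar, sinChar, suNorm]
    push_cast
    field_simp
  have hsub : (2 * n : ℤ) ∣ r - s ↔ r = s := by
    refine ⟨fun h => ?_, fun h => by simp [h]⟩
    have := Int.eq_zero_of_abs_lt_dvd h (by rw [abs_lt]; omega)
    omega
  have hadd : (2 * n : ℤ) ∣ r + s ↔ r = 2 * n - s := by
    refine ⟨fun h => ?_, fun h => ⟨1, by omega⟩⟩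
    have := Int.eq_zero_of_abs_lt_dvd (dvd_sub_self_right.2 h) (by rw [abs_lt]; omega)
    omega
  rw [sum_congr rfl hterm, ← mul_sum, sum_Ico_one_eq_sum_range (by simp), sum_range_sin_mul_sin,
    ← mul_assoc, div_mul_div_cancel₀ hn, div_self two_ne_zero, one_mul]
  simp only [hsub, hadd]

/-- Verlinde's formula: by Clebsch–Gordan, `sinChar p * sinChar q` is a sum of `sinChar`s, and
orthogonality picks out the coefficient of `sinChar s`. -/
lemma sum_inv_suNorm_mul_sinChar {n p q s : ℕ} (hp : 0 < p) (hpn : p < n) (hq : 0 < q)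
    (hqn : q < n) (hs : 0 < s) (hsn : s < n) :
    ∑ j ∈ Ico 1 n, (suNorm n j)⁻¹ * (sinChar p (j * π / n) * sinChar q (j * π / n) *
        sinChar s (j * π / n)) =
      if p < q + s ∧ q < p + s ∧ s < p + q ∧ Odd (p + q + s) ∧ p + q + s < 2 * n
        then 1 else 0 := by
  wlog hpq : p ≤ q generalizing p q
  · have hswap := this hq hqn hp hpn (by omega)
    simp only [mul_comm (sinChar p _)]
    rw [hswap]
    simp only [Nat.odd_iff]
    exact if_congr (by omega) rfl rfl
  have hterm (j : ℕ) (hj : j ∈ Ico 1 n) :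
      (suNorm n j)⁻¹ * (sinChar p (j * π / n) * sinChar q (j * π / n) *
        sinChar s (j * π / n)) = ∑ i ∈ range p, (suNorm n j)⁻¹ *
          (sinChar (q - p + 1 + 2 * i) (j * π / n) * sinChar s (j * π / n)) := by
    rw [mem_Ico] at hj
    rw [sinChar_mul_sinChar hpq (sin_nat_mul_pi_div_pos hj.1 hj.2).ne', sum_mul, mul_sum]
  have hcoeff (i : ℕ) (hi : i ∈ range p) := sum_inv_suNorm_mul_sinChar_mul_sinChar
    (r := q - p + 1 + 2 * i) (by omega) (by rw [mem_range] at hi; omega) hs hsn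
  rw [sum_congr rfl hterm, sum_comm, sum_congr rfl hcoeff, sum_sub_distrib,
    sum_range_ite_add_two_mul_eq hpq, sum_range_ite_add_two_mul_eq hpq]
  simp only [Nat.odd_iff]
  split_ifs <;> first | (norm_num; done) | (exfalso; omega)

/-! ### The fusion rules of `SO(3)` -/

/-- The number of elements of `{j, n - j}`: the characters of odd dimension do not distinguish
the classes `jπ / n` and `(n - j)π / n`. -/
def foldMult (n j : ℕ) : ℕ := if 2 * j = n then 1 else 2

lemma sum_Ico_one_fold {n : ℕ} {f : ℕ → ℝ} (hf : ∀ j, 0 < j → j < n → f (n - j) = f j) :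
    ∑ j ∈ Ico 1 n, f j = ∑ j ∈ Ico 1 (n / 2 + 1), foldMult n j * f j := by
  obtain hn | hn := lt_or_ge n 2
  · interval_cases n <;> simp
  have hupper : ∑ j ∈ Ico (n / 2 + 1) n, f j = ∑ j ∈ Ico 1 (n / 2 + 1) with 2 * j ≠ n, f j := by
    refine sum_nbij' (n - ·) (n - ·) ?_ ?_ ?_ ?_ ?_ <;>
      simp only [mem_filter, mem_Ico] <;> intro j hj
    iterate 4 omega
    exact (hf j (by omega) (by omega)).symm
  rw [← sum_Ico_consecutive f (show 1 ≤ n / 2 + 1 by omega) (by omega), hupper, sum_filter,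
    ← sum_add_distrib]
  refine sum_congr rfl fun j _ => ?_
  rw [foldMult]
  split_ifs <;> first | contradiction | (push_cast; ring)

lemma sum_range_one_add_neg_one_pow_mul (f : ℕ → ℝ) (m : ℕ) :
    ∑ k ∈ range m, (1 + (-1) ^ k) * f k = 2 * ∑ a ∈ range ((m + 1) / 2), f (2 * a) := by
  induction m with
  | zero => simp
  | succ m ih =>
    rw [sum_range_succ, ih]
    obtain ⟨r, rfl | rfl⟩ := Nat.even_or_odd' m
    · rw [show (2 * r + 1 + 1) / 2 = r + 1 by omega, show (2 * r + 1) / 2 = r by omega,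
        sum_range_succ, pow_mul]
      norm_num
      ring
    · rw [show (2 * r + 1 + 1 + 1) / 2 = r + 1 by omega, show (2 * r + 1 + 1) / 2 = r + 1 by omega,
        pow_succ, pow_mul]
      norm_num

/-- The squared norm of the vector of the values `sinChar p (jπ / n)`, `0 < p < n` odd: the analogue
of `suNorm` for the representations of `SU(2)` that factor through `SO(3)`. -/
noncomputable def soNorm (n j : ℕ) : ℝ := suNorm n j / foldMult n j

lemma inv_soNorm (n j : ℕ) : (soNorm n j)⁻¹ = foldMult n j * (suNorm n j)⁻¹ := by
  rw [soNorm, inv_div, div_eq_mul_inv]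

lemma soNorm_pos {n j : ℕ} (hj : 0 < j) (hjn : j < n) : 0 < soNorm n j := by
  have := suNorm_pos hj hjn
  rw [soNorm, foldMult]
  split_ifs <;> positivity

lemma sum_sinChar_odd_mul_sinChar_odd {n i j : ℕ} (hi : 0 < i) (hin : 2 * i ≤ n) (hj : 0 < j)
    (hjn : 2 * j ≤ n) :
    ∑ a ∈ range (n / 2), sinChar (2 * a + 1) (i * π / n) * sinChar (2 * a + 1) (j * π / n) =
      if i = j then soNorm n i else 0 := by
  have hsymm (a : ℕ) : (-1 : ℝ) ^ a * sinChar (a + 1) (i * π / n) =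
      sinChar (a + 1) ((n - i : ℕ) * π / n) := by
    rw [← pi_sub_nat_mul_pi_div (show i < n by omega), sinChar, sinChar, mul_sub,
      Real.sin_nat_mul_pi_sub, Real.sin_pi_sub, pow_succ]
    ring
  have hparity := sum_range_one_add_neg_one_pow_mul
    (fun a => sinChar (a + 1) (i * π / n) * sinChar (a + 1) (j * π / n)) (n - 1)
  simp only [add_mul, one_mul, ← mul_assoc, hsymm] at hparity
  rw [sum_add_distrib, sum_sinChar_mul_sinChar hi (by omega) hj (by omega),
    sum_sinChar_mul_sinChar (by omega) (by omega) hj (by omega), suNorm_sub (by omega),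
    show (n - 1 + 1) / 2 = n / 2 by omega] at hparity
  rw [soNorm, foldMult]
  split_ifs at hparity ⊢ <;> first | omega | (push_cast; linarith)

lemma sum_inv_soNorm_mul_sinChar_odd {n a b c : ℕ} (ha : a < n / 2) (hb : b < n / 2)
    (hc : c < n / 2) :
    ∑ j ∈ Ico 1 (n / 2 + 1), (soNorm n j)⁻¹ * (sinChar (2 * a + 1) (j * π / n) *
        sinChar (2 * b + 1) (j * π / n) * sinChar (2 * c + 1) (j * π / n)) =
      if a ≤ b + c ∧ b ≤ a + c ∧ c ≤ a + b ∧ a + b + c + 2 ≤ n then 1 else 0 := by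
  have hfold := sum_Ico_one_fold (n := n) (f := fun j => (suNorm n j)⁻¹ *
    (sinChar (2 * a + 1) (j * π / n) * sinChar (2 * b + 1) (j * π / n) *
      sinChar (2 * c + 1) (j * π / n))) fun j _ hj => by
    simp only [← pi_sub_nat_mul_pi_div hj, suNorm_sub hj, sinChar_odd_pi_sub]
  rw [sum_inv_suNorm_mul_sinChar (by omega) (by omega) (by omega) (by omega) (by omega)
    (by omega)] at hfold
  simp only [inv_soNorm, mul_assoc, Nat.odd_iff] at hfold ⊢
  rw [← hfold]
  exact if_congr (by omega) rfl rfl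

/-! ### Fusion rules and state sums -/

open Classical in
/-- A fusion rule on a finite set `A` of labels, with its character table: `J` indexes the
characters, and the last field is Verlinde's formula, by which the characters diagonalise `rule`. -/
structure FusionRule (A J : Type*) [Fintype A] [Fintype J] where
  rule : A → A → A → Prop
  unit : A
  char : J → A → ℝ
  norm : J → ℝ
  rule_unit : ∀ a b, rule a b unit ↔ a = b
  char_unit : ∀ j, char j unit = 1
  norm_pos : ∀ j, 0 < norm j
  sum_char_mul_char : ∀ i j, ∑ a, char i a * char j a = if i = j then norm i else 0
  sum_inv_norm_mul_char : ∀ a b c,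
    ∑ j, (norm j)⁻¹ * (char j a * char j b * char j c) = if rule a b c then 1 else 0

namespace FusionRule

variable {A J : Type*} [Fintype A] [Fintype J] (R : FusionRule A J)

/-- The factor which a vertex of degree `1`, whose edge may carry any label, contributes to a state
sum. -/
def leafWeight (j : J) : ℝ := ∑ a, R.char j a

lemma sum_inv_norm_mul_leafWeight_mul_char (a : A) :
    ∑ j, (R.norm j)⁻¹ * (R.leafWeight j * R.char j a) = 1 := by
  classical
  have hpair (b : A) : ∑ j, (R.norm j)⁻¹ * (R.char j b * R.char j a) = if b = a then 1 else 0 := by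
    have := R.sum_inv_norm_mul_char b a R.unit
    simpa only [R.char_unit, mul_one, R.rule_unit] using this
  simp only [leafWeight, sum_mul, mul_sum]
  rw [sum_comm, sum_congr rfl fun b _ => hpair b, sum_ite_eq' univ a, if_pos (mem_univ a)]

end FusionRule

lemma sum_fin_succ_eq_sum_Ico {M : Type*} [AddCommMonoid M] (f : ℕ → M) (m : ℕ) :
    ∑ j : Fin m, f (j + 1) = ∑ j ∈ Ico 1 (m + 1), f j := by
  rw [Fin.sum_univ_eq_sum_range (fun j => f (j + 1)), range_eq_Ico, sum_Ico_add', zero_add]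

/-- The triangle inequalities, with a bound `t` on the perimeter. -/
def TriangleLe {R : Type*} [Add R] [LE R] (t a b c : R) : Prop :=
  a ≤ b + c ∧ b ≤ a + c ∧ c ≤ a + b ∧ a + b + c ≤ t

/-- The labels at a vertex of a lattice point of `t Q_G`: the coordinate of the vertex itself is
half the perimeter, which is at most `t`. -/
def EvenTriangleLe (t a b c : ℕ) : Prop := TriangleLe (2 * t) a b c ∧ Even (a + b + c)

/-- The fusion rule of `SU(2)` at level `t`; the label `a` is the representation of dimension
`a + 1`. -/
noncomputable def suFusionRule (t : ℕ) : FusionRule (Fin (t + 1)) (Fin (t + 1)) where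
  rule a b c := EvenTriangleLe t a b c
  unit := 0
  char j a := sinChar (a + 1) ((j + 1 : ℕ) * π / (t + 2 : ℕ))
  norm j := suNorm (t + 2) (j + 1)
  rule_unit a b := by
    have := a.isLt
    simp only [EvenTriangleLe, TriangleLe, Fin.ext_iff, Nat.even_iff, Fin.coe_ofNat_eq_mod,
      Nat.zero_mod]
    omega
  char_unit j := sinChar_one (by omega) (by omega)
  norm_pos j := suNorm_pos (by omega) (by omega)
  sum_char_mul_char i j := by
    rw [Fin.sum_univ_eq_sum_range (fun a => sinChar (a + 1) ((i + 1 : ℕ) * π / (t + 2 : ℕ)) *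
      sinChar (a + 1) ((j + 1 : ℕ) * π / (t + 2 : ℕ))) (t + 1)]
    refine (sum_sinChar_mul_sinChar (by omega) (by omega) (by omega) (by omega)).trans ?_
    simp only [Nat.add_right_cancel_iff, Fin.ext_iff]
  sum_inv_norm_mul_char a b c := by
    classical
    rw [sum_fin_succ_eq_sum_Ico fun j => (suNorm (t + 2) j)⁻¹ *
      (sinChar (a + 1) (j * π / (t + 2 : ℕ)) * sinChar (b + 1) (j * π / (t + 2 : ℕ)) *
        sinChar (c + 1) (j * π / (t + 2 : ℕ)))]
    refine (sum_inv_suNorm_mul_sinChar (by omega) (by omega) (by omega) (by omega) (by omega)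
      (by omega)).trans (if_congr ?_ rfl rfl)
    simp only [EvenTriangleLe, TriangleLe, Nat.even_iff, Nat.odd_iff]
    omega

/-- The restriction of `suFusionRule t` to the representations of `SO(3)`; the label `a` is the
representation of dimension `2 * a + 1`. -/
noncomputable def soFusionRule (t : ℕ) : FusionRule (Fin (t / 2 + 1)) (Fin (t / 2 + 1)) where
  rule a b c := TriangleLe t (a : ℕ) b c
  unit := 0
  char j a := sinChar (2 * a + 1) ((j + 1 : ℕ) * π / (t + 2 : ℕ))
  norm j := soNorm (t + 2) (j + 1)
  rule_unit a b := by
    have := a.isLt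
    simp only [TriangleLe, Fin.ext_iff, Fin.coe_ofNat_eq_mod, Nat.zero_mod]
    omega
  char_unit j := sinChar_one (by omega) (by omega)
  norm_pos j := soNorm_pos (by omega) (by omega)
  sum_char_mul_char i j := by
    rw [Fin.sum_univ_eq_sum_range (fun a => sinChar (2 * a + 1) ((i + 1 : ℕ) * π / (t + 2 : ℕ)) *
      sinChar (2 * a + 1) ((j + 1 : ℕ) * π / (t + 2 : ℕ))) (t / 2 + 1)]
    have horth := sum_sinChar_odd_mul_sinChar_odd (n := t + 2) (i := i + 1) (j := j + 1) (by omega)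
      (by omega) (by omega) (by omega)
    rw [show (t + 2) / 2 = t / 2 + 1 by omega] at horth
    simpa only [Nat.add_right_cancel_iff, Fin.ext_iff] using horth
  sum_inv_norm_mul_char a b c := by
    classical
    rw [sum_fin_succ_eq_sum_Ico fun j => (soNorm (t + 2) j)⁻¹ *
      (sinChar (2 * a + 1) (j * π / (t + 2 : ℕ)) * sinChar (2 * b + 1) (j * π / (t + 2 : ℕ)) *
        sinChar (2 * c + 1) (j * π / (t + 2 : ℕ)))]
    have hverlinde := sum_inv_soNorm_mul_sinChar_odd (n := t + 2) (a := a) (b := b) (c := c)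
      (by omega) (by omega) (by omega)
    rw [show (t + 2) / 2 = t / 2 + 1 by omega] at hverlinde
    exact hverlinde.trans (if_congr (by simp only [TriangleLe]; omega) rfl rfl)

/-- The fusion rule of the group `ℤ/2`. -/
noncomputable def parityFusionRule : FusionRule (Fin 2) (Fin 2) where
  rule a b c := Even (a + b + c : ℕ)
  unit := 0
  char j a := (-1) ^ (j * a : ℕ)
  norm _ := 2
  rule_unit := by decide
  char_unit := by simp
  norm_pos _ := two_pos
  sum_char_mul_char i j := by
    fin_cases i <;> fin_cases j <;> norm_num [Fin.sum_univ_two]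
  sum_inv_norm_mul_char a b c := by
    fin_cases a <;> fin_cases b <;> fin_cases c <;> norm_num [Fin.sum_univ_two, Nat.even_iff]

/-! ### State sums on graphs -/

lemma card_filter_mem_eq_ncard {γ : Type*} {S s : Set γ} [Fintype S] [DecidablePred (· ∈ s)]
    (hs : s ⊆ S) : #{x : S | (x : γ) ∈ s} = s.ncard := by
  rw [← Set.ncard_coe_finset,
    ← Set.ncard_image_of_injective _ (Subtype.val_injective (p := (· ∈ S)))]
  congr 1
  ext x
  simpa using @hs x

section Star

variable {α β : Type*} {G : Graph α β}

open Classical in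
/-- The number of ends of the edge `e` at the vertex `v`. -/
noncomputable def incMult (G : Graph α β) (v : α) (e : β) : ℕ :=
  (if G.Inc e v then 1 else 0) + if G.IsLoopAt e v then 1 else 0

open Classical in
lemma incMult_eq_of_isLink {e : β} {x y : α} (h : G.IsLink e x y) (v : α) :
    incMult G v e = (if v = x then 1 else 0) + if v = y then 1 else 0 := by
  have hinc : G.Inc e v ↔ v = x ∨ v = y :=
    ⟨fun hv => hv.eq_or_eq_of_isLink h, by rintro (rfl | rfl); exacts [h.inc_left, h.inc_right]⟩
  have hloop : G.IsLoopAt e v ↔ v = x ∧ v = y := by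
    refine ⟨fun hv => ⟨hv.eq_of_inc h.inc_left, hv.eq_of_inc h.inc_right⟩, ?_⟩
    rintro ⟨rfl, hy⟩
    rwa [← hy] at h
  rw [incMult, hinc, hloop]
  split_ifs <;> first | rfl | (exfalso; tauto)

lemma prod_pow_incMult [Fintype V(G)] {M : Type*} [CommMonoid M] {e : β} {x y : V(G)}
    (h : G.IsLink e x y) (f : V(G) → M) : ∏ v : V(G), f v ^ incMult G v e = f x * f y := by
  classical
  simp only [incMult_eq_of_isLink h, pow_add, prod_mul_distrib, Subtype.coe_inj, pow_ite, pow_one,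
    pow_zero, prod_ite_eq', mem_univ, if_true]

lemma sum_incMult [Fintype V(G)] (e : E(G)) : ∑ v : V(G), incMult G v e = 2 := by
  obtain ⟨x, y, h⟩ := G.exists_isLink_of_mem_edgeSet e.2
  have hprod := prod_pow_incMult (x := ⟨x, h.left_mem⟩) (y := ⟨y, h.right_mem⟩) h
    fun _ => Multiplicative.ofAdd 1
  rwa [prod_pow_eq_pow_sum, ← ofAdd_nsmul, ← ofAdd_add, Multiplicative.ofAdd.injective.eq_iff,
    smul_eq_mul, mul_one] at hprod

lemma degree_eq_sum_incMult {F : Set β} [Fintype F] (hF : E(G) ⊆ F) (v : α) :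
    G.degree v = ∑ e : F, incMult G v e := by
  classical
  simp only [incMult, sum_add_distrib, ← card_filter]
  exact (congrArg₂ (· + ·)
    (card_filter_mem_eq_ncard (s := G.incidenceSet v) fun _ h => hF h.edge_mem)
    (card_filter_mem_eq_ncard (s := G.loopSet v) fun _ h => hF h.edge_mem)).symm

variable [Fintype E(G)]

/-- The edges at the vertex `v`, a loop being listed twice. -/
noncomputable def vertexStar (G : Graph α β) [Fintype E(G)] (v : α) : Multiset E(G) :=
  ∑ e : E(G), Multiset.replicate (incMult G v e) e

lemma count_vertexStar [DecidableEq E(G)] (v : α) (e : E(G)) :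
    (vertexStar G v).count e = incMult G v e := by
  simp [vertexStar, Multiset.count_sum', Multiset.count_replicate]

lemma card_vertexStar (v : α) : (vertexStar G v).card = G.degree v := by
  simp only [vertexStar, Multiset.card_sum, Multiset.card_replicate,
    degree_eq_sum_incMult subset_rfl]

@[to_additive]
lemma prod_map_vertexStar {M : Type*} [CommMonoid M] (v : α) (f : E(G) → M) :
    ((vertexStar G v).map f).prod = ∏ e : E(G), f e ^ incMult G v e := by
  classical
  rw [Finset.prod_multiset_map_count]
  simp only [count_vertexStar]
  refine prod_subset (subset_univ _) fun e _ he => ?_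
  rw [Multiset.mem_toFinset, ← Multiset.count_eq_zero, count_vertexStar] at he
  rw [he, pow_zero]

lemma edgesAt_iff_vertexStar_eq {v : α} {a b c : E(G)} :
    G.EdgesAt v a b c ↔ vertexStar G v = {a, b, c} := by
  classical
  simp only [Multiset.ext, count_vertexStar, Multiset.insert_eq_cons, Multiset.count_cons,
    Multiset.count_singleton, Graph.EdgesAt, incMult]
  refine forall_congr' fun e => ?_
  rw [eq_comm]
  congr! 1
  ring_nf

lemma sum_degree [Fintype V(G)] : ∑ v : V(G), G.degree v = 2 * Fintype.card E(G) := by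
  simp only [← card_vertexStar, vertexStar, Multiset.card_sum, Multiset.card_replicate]
  rw [sum_comm, sum_congr rfl fun e _ => sum_incMult e, sum_const, smul_eq_mul, mul_comm,
    card_univ]

end Star

section Labelings

variable {α β : Type*} {G : Graph α β}

lemma eq_of_forall_isLink (hconn : G.IsConnected) {X : Type*} {σ : V(G) → X}
    (hσ : ∀ (e : β) (x y : V(G)), G.IsLink e x y → σ x = σ y) (x y : V(G)) : σ x = σ y := by
  have hwalk : ∀ z, Relation.ReflTransGen G.Adj x z → ∀ hz : z ∈ V(G), σ x = σ ⟨z, hz⟩ := by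
    intro z hxz
    induction hxz with
    | refl => exact fun _ => rfl
    | tail _ hadj ih =>
      obtain ⟨e, he⟩ := hadj
      exact fun hz => (ih he.left_mem).trans (hσ e ⟨_, he.left_mem⟩ ⟨_, hz⟩ he)
  exact hwalk y (hconn.2 x x.2 y y.2) y.2

open Classical in
/-- Expanding the product over the vertices gives a sum over the assignments `σ` of characters to
vertices; orthogonality along each edge kills every `σ` that is not constant. -/
theorem sum_prod_vertex [Fintype V(G)] [Fintype E(G)] (hconn : G.IsConnected) {A J : Type*}
    [Fintype A] [Fintype J] (R : FusionRule A J) (ν : V(G) → J → ℝ) :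
    ∑ w : E(G) → A, ∏ v : V(G), ∑ j, ν v j * ((vertexStar G v).map fun e => R.char j (w e)).prod =
      ∑ j, (∏ v, ν v j) * R.norm j ^ Fintype.card E(G) := by
  have : Nonempty V(G) := hconn.1.to_subtype
  let edgeFactor (σ : V(G) → J) (e : E(G)) : ℝ := ∑ a, ∏ v : V(G), R.char (σ v) a ^ incMult G v e
  have hedge (σ : V(G) → J) (e : E(G)) (x y : V(G)) (h : G.IsLink e x y) :
      edgeFactor σ e = if σ x = σ y then R.norm (σ x) else 0 := by
    simp only [edgeFactor, ← R.sum_char_mul_char]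
    exact sum_congr rfl fun a _ => prod_pow_incMult h fun v => R.char (σ v) a
  have hexpand : ∑ w : E(G) → A, ∏ v : V(G), ∑ j, ν v j *
      ((vertexStar G v).map fun e => R.char j (w e)).prod =
      ∑ σ : V(G) → J, (∏ v, ν v (σ v)) * ∏ e, edgeFactor σ e := by
    simp only [Fintype.prod_sum, prod_mul_distrib, prod_map_vertexStar, edgeFactor]
    rw [sum_comm]
    simp only [mul_sum]
    refine sum_congr rfl fun σ _ => sum_congr rfl fun w _ => ?_
    rw [prod_comm]
  rw [hexpand]
  symm
  refine sum_of_injOn (fun j _ => j) ?_ (by simp) ?_ fun j _ => ?_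
  · exact fun i _ j _ hij => congrFun hij (Classical.arbitrary V(G))
  · intro σ _ hσ
    obtain ⟨e, x, y, he, hne⟩ : ∃ (e : β) (x y : V(G)), G.IsLink e x y ∧ σ x ≠ σ y := by
      by_contra! hall
      exact hσ ⟨σ (Classical.arbitrary V(G)), by simp,
        funext fun v => eq_of_forall_isLink hconn hall _ v⟩
    have hzero : ∏ e, edgeFactor σ e = 0 := prod_eq_zero (mem_univ (⟨e, he.edge_mem⟩ : E(G)))
      ((hedge σ _ x y he).trans (if_neg hne))
    rw [hzero, mul_zero]
  · congr 1
    refine (prod_eq_pow_card fun e _ => ?_).symm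
    obtain ⟨x, y, h⟩ := G.exists_isLink_of_mem_edgeSet e.2
    rw [hedge _ e ⟨x, h.left_mem⟩ ⟨y, h.right_mem⟩ h, if_pos rfl]

/-- The labelings of the edges that satisfy `rule` at every internal node. -/
def labelings {A : Type*} (G : Graph α β) (rule : A → A → A → Prop) : Set (E(G) → A) :=
  {w | ∀ v ∈ G.internalNodes, ∀ a b c, G.EdgesAt v a b c → rule (w a) (w b) (w c)}

/-- The nodes of degree `1`. -/
def leaves (G : Graph α β) : Set α := {v | v ∈ V(G) ∧ G.degree v = 1}

lemma leaves_subset (G : Graph α β) : leaves G ⊆ V(G) := fun _ h => h.1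

lemma internalNodes_subset (G : Graph α β) : G.internalNodes ⊆ V(G) := fun _ h => h.1

open Classical in
lemma sum_inv_norm_mul_prod_vertexStar [Fintype E(G)] {A J : Type*} [Fintype A] [Fintype J]
    (R : FusionRule A J) (w : E(G) → A) {v : α} (hv : v ∈ V(G))
    (hdeg : G.degree v = 1 ∨ G.degree v = 3) :
    ∑ j, ((R.norm j)⁻¹ * if v ∈ leaves G then R.leafWeight j else 1) *
      ((vertexStar G v).map fun e => R.char j (w e)).prod =
    if v ∈ G.internalNodes → ∀ a b c, G.EdgesAt v a b c → R.rule (w a) (w b) (w c)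
      then 1 else 0 := by
  obtain hdeg | hdeg := hdeg
  · have hint : v ∉ G.internalNodes := fun h => by have := h.2; omega
    obtain ⟨e, he⟩ := Multiset.card_eq_one.1 ((card_vertexStar v).trans hdeg)
    simpa [leaves, hv, hdeg, hint, he, mul_assoc] using
      R.sum_inv_norm_mul_leafWeight_mul_char (w e)
  · obtain ⟨a, b, c, habc⟩ := Multiset.card_eq_three.1 ((card_vertexStar v).trans hdeg)
    have hfactor (a b c : E(G)) (h : G.EdgesAt v a b c) :
        ∑ j, ((R.norm j)⁻¹ * if v ∈ leaves G then R.leafWeight j else 1) *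
          ((vertexStar G v).map fun e => R.char j (w e)).prod =
        if R.rule (w a) (w b) (w c) then 1 else 0 := by
      rw [← R.sum_inv_norm_mul_char, edgesAt_iff_vertexStar_eq.1 h]
      simp [leaves, hdeg, mul_assoc]
    by_cases hrule : v ∈ G.internalNodes → ∀ a b c, G.EdgesAt v a b c → R.rule (w a) (w b) (w c)
    · rw [if_pos hrule, hfactor a b c (edgesAt_iff_vertexStar_eq.2 habc),
        if_pos (hrule ⟨hv, hdeg⟩ a b c (edgesAt_iff_vertexStar_eq.2 habc))]
    · rw [if_neg hrule]
      push Not at hrule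
      obtain ⟨-, a, b, c, h, hnot⟩ := hrule
      rw [hfactor a b c h, if_neg hnot]

theorem ncard_labelings (hV : V(G).Finite) (hE : E(G).Finite) (h13 : G.IsOneThree)
    (hconn : G.IsConnected) {A J : Type*} [Fintype A] [Fintype J] (R : FusionRule A J) :
    ((labelings G R.rule).ncard : ℝ) = ∑ j, R.norm j ^ ((E(G).ncard : ℤ) - V(G).ncard) *
      R.leafWeight j ^ (leaves G).ncard := by
  classical
  have := hV.fintype
  have := hE.fintype
  have hindicator (w : E(G) → A) : (if w ∈ labelings G R.rule then (1 : ℝ) else 0) =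
      ∏ v : V(G), ∑ j, ((R.norm j)⁻¹ * if (v : α) ∈ leaves G then R.leafWeight j else 1) *
        ((vertexStar G v).map fun e => R.char j (w e)).prod := by
    rw [prod_congr rfl fun (v : V(G)) _ => sum_inv_norm_mul_prod_vertexStar R w v.2 (h13 v v.2)]
    simp only [prod_ite_zero, prod_const_one, mem_univ, forall_const, labelings]
    refine if_congr ?_ rfl rfl
    exact ⟨fun h v hv => h v.1 hv, fun h v hv => h ⟨v, hv.1⟩ hv⟩
  have hcard : ((labelings G R.rule).ncard : ℝ) =
      ∑ w, if w ∈ labelings G R.rule then (1 : ℝ) else 0 := by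
    rw [sum_boole, ← Set.ncard_coe_finset, coe_filter_univ, Set.ofPred_mem_eq]
  rw [hcard, sum_congr rfl fun w _ => hindicator w, sum_prod_vertex hconn R]
  refine sum_congr rfl fun j _ => ?_
  rw [prod_mul_distrib, prod_const, card_univ, prod_ite, prod_const, prod_const_one,
    card_filter_mem_eq_ncard (leaves_subset G), zpow_sub₀ (R.norm_pos j).ne', zpow_natCast,
    zpow_natCast, inv_pow,
    Set.ncard_eq_toFinset_card' E(G), Set.ncard_eq_toFinset_card' V(G), Set.toFinset_card,
    Set.toFinset_card]
  ring

end Labelings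

/-! ### Numbers of vertices, edges and leaves -/

section Counting

variable {α β : Type*} {G : Graph α β}

/-- The simple graph on the vertices of `G` underlying its spanning subgraph with edge set `F`. -/
def simpleOn (G : Graph α β) (F : Set β) : SimpleGraph V(G) where
  Adj x y := x ≠ y ∧ ∃ e ∈ F, G.IsLink e x y
  symm := ⟨fun _ _ ⟨hne, e, he, h⟩ => ⟨hne.symm, e, he, h.symm⟩⟩
  loopless := ⟨fun _ h => h.1 rfl⟩

lemma simpleOn_reachable_of_isLink {F : Set β} {e : β} (he : e ∈ F) {x y : V(G)}
    (h : G.IsLink e x y) : (simpleOn G F).Reachable x y := by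
  by_cases hxy : x = y
  · rw [hxy]
  · exact SimpleGraph.Adj.reachable ⟨hxy, e, he, h⟩

lemma simpleOn_connected (hconn : G.IsConnected) {F : Set β}
    (h : ∀ e (x y : V(G)), G.IsLink e x y → (simpleOn G F).Reachable x y) :
    (simpleOn G F).Connected := by
  have : Nonempty V(G) := hconn.1.to_subtype
  exact ⟨fun x y => SimpleGraph.ConnectedComponent.eq.1 <| eq_of_forall_isLink hconn
    (fun e u v he => SimpleGraph.ConnectedComponent.eq.2 (h e u v he)) x y⟩

lemma ncard_vertexSet_le_of_simpleOn_connected {F : Set β} (hF : F.Finite)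
    (h : (simpleOn G F).Connected) : V(G).ncard ≤ F.ncard + 1 := by
  have hlink : ∀ s : (simpleOn G F).edgeSet, ∃ e : F, ∀ x y : V(G),
      (s : Sym2 V(G)) = s(x, y) → G.IsLink e x y := by
    rintro ⟨s, hs⟩
    induction s using Sym2.ind with
    | _ x y =>
      obtain ⟨-, e, he, hl⟩ := hs
      refine ⟨⟨e, he⟩, fun u v huv => ?_⟩
      obtain ⟨rfl, rfl⟩ | ⟨rfl, rfl⟩ := Sym2.eq_iff.1 huv
      exacts [hl, hl.symm]
  choose f hf using hlink
  have hinj : Function.Injective f := by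
    rintro ⟨s, hs⟩ ⟨t, ht⟩ hst
    induction s using Sym2.ind with
    | _ x y =>
      induction t using Sym2.ind with
      | _ u v =>
        have hxy := hf ⟨_, hs⟩ x y rfl
        rw [hst] at hxy
        rcases hxy.eq_and_eq_or_eq_and_eq (hf ⟨_, ht⟩ u v rfl) with ⟨h1, h2⟩ | ⟨h1, h2⟩
        · simp only [Subtype.ext h1, Subtype.ext h2]
        · simp only [Subtype.ext h1, Subtype.ext h2, Sym2.eq_swap]
  have := hF.to_subtype
  rw [← Nat.card_coe_set_eq, ← Nat.card_coe_set_eq F]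
  exact h.card_vert_le_card_edgeSet_add_one.trans
    (Nat.add_le_add_right (Nat.card_le_card_of_injective f hinj) 1)

lemma simpleOn_reachable_of_cycle {n : ℕ} {x : Fin (n + 1) → V(G)} {e : Fin (n + 1) → β}
    (he : Function.Injective e) (hl : ∀ i, G.IsLink (e i) (x i) (x (i + 1))) :
    (simpleOn G (E(G) \ {e 0})).Reachable (x 1) (x 0) := by
  have hpath (k : ℕ) (hk : k ≤ n) :
      (simpleOn G (E(G) \ {e 0})).Reachable (x 1) (x (Fin.ofNat (n + 1) (k + 1))) := by
    induction k with
    | zero => rfl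
    | succ k ih =>
      refine (ih (by omega)).trans ?_
      have hlink := hl (Fin.ofNat (n + 1) (k + 1))
      rw [show Fin.ofNat (n + 1) (k + 1) + 1 = Fin.ofNat (n + 1) (k + 1 + 1) from
        Fin.ext (by simp [Fin.val_add])] at hlink
      refine simpleOn_reachable_of_isLink (Set.mem_sdiff_of_mem hlink.edge_mem fun h => ?_) hlink
      have hval := congrArg Fin.val (he h)
      rw [Fin.val_ofNat, Nat.mod_eq_of_lt (by omega)] at hval
      exact Nat.succ_ne_zero k hval
  simpa using hpath n le_rfl

lemma ncard_vertexSet_le_of_not_isAcyclic (hE : E(G).Finite) (hconn : G.IsConnected)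
    (hcyc : ¬ G.IsAcyclic) : V(G).ncard ≤ E(G).ncard := by
  unfold Graph.IsAcyclic at hcyc
  push Not at hcyc
  obtain ⟨n, x, e, -, he, hl⟩ := hcyc
  lift x to Fin (n + 1) → V(G) using fun i => (hl i).left_mem
  have hreach := simpleOn_reachable_of_cycle he hl
  have hlink : G.IsLink (e 0) (x 0) (x 1) := by simpa using hl 0
  have hconn' : (simpleOn G (E(G) \ {e 0})).Connected := by
    refine simpleOn_connected hconn fun f u v hf => ?_
    by_cases hfe : f = e 0
    · subst hfe
      rcases hf.eq_and_eq_or_eq_and_eq hlink with ⟨hu, hv⟩ | ⟨hu, hv⟩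
      · rw [Subtype.ext hu, Subtype.ext hv]
        exact hreach.symm
      · rwa [Subtype.ext hu, Subtype.ext hv]
    · exact simpleOn_reachable_of_isLink (Set.mem_sdiff_of_mem hf.edge_mem hfe) hf
  have hcard := ncard_vertexSet_le_of_simpleOn_connected (hE.subset Set.sdiff_subset) hconn'
  rwa [Set.ncard_sdiff_singleton_add_one hlink.edge_mem hE] at hcard

lemma simpleOn_isAcyclic (hac : G.IsAcyclic) (F : Set β) : (simpleOn G F).IsAcyclic := by
  intro v c hc
  have hlen := hc.three_le_length
  obtain ⟨n, hn⟩ : ∃ n, c.length = n + 1 := ⟨c.length - 1, by omega⟩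
  have hadj : ∀ i : Fin (n + 1),
      (simpleOn G F).Adj (c.getVert i) (c.getVert (i + 1 : Fin (n + 1))) := by
    intro i
    have h := c.adj_getVert_succ (i := i) (by omega)
    by_cases hi : i = Fin.last n
    · subst hi
      rw [Fin.val_last, ← hn, SimpleGraph.Walk.getVert_length] at h
      simpa only [Fin.last_add_one, Fin.val_last, Fin.val_zero, SimpleGraph.Walk.getVert_zero]
        using h
    · rwa [Fin.val_add_one_of_lt (Fin.lt_last_iff_ne_last.2 hi)]
  choose _ e _ hl using hadj
  have hinj : Function.Injective fun i : Fin (n + 1) => (c.getVert i : α) := fun i j hij =>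
    Fin.ext <| hc.getVert_injOn' (by simp only [Set.mem_ofPred_eq]; omega)
      (by simp only [Set.mem_ofPred_eq]; omega) (Subtype.ext hij)
  refine hac n (fun i => c.getVert i) e hinj (fun i j hij => ?_) hl
  have h := hl i
  rw [hij] at h
  rcases h.eq_and_eq_or_eq_and_eq (hl j) with ⟨hi, -⟩ | ⟨hi, hj⟩
  · exact hinj hi
  · have hji : i = i + 1 + 1 := (hinj hi).trans (congrArg (· + 1) (hinj hj).symm)
    rw [add_assoc, left_eq_add] at hji
    have hval := congrArg Fin.val hji
    rw [Fin.val_add, Fin.val_one', Nat.mod_eq_of_lt (a := 1) (by omega),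
      Nat.mod_eq_of_lt (by omega)] at hval
    simp at hval

lemma ne_of_isLink_of_isAcyclic (hac : G.IsAcyclic) {e : β} {x y : α} (h : G.IsLink e x y) :
    x ≠ y := by
  rintro rfl
  exact hac 0 (fun _ => x) (fun _ => e) (fun i j _ => Subsingleton.elim (α := Fin 1) i j)
    (fun i j _ => Subsingleton.elim (α := Fin 1) i j) fun _ => h

lemma eq_of_isLink_of_isAcyclic (hac : G.IsAcyclic) {e f : β} {x y : α} (he : G.IsLink e x y)
    (hf : G.IsLink f x y) : e = f := by
  by_contra hef
  refine hac 1 ![x, y] ![e, f] ?_ ?_ ?_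
  · simpa [Function.Injective, Fin.forall_fin_two, eq_comm] using ne_of_isLink_of_isAcyclic hac he
  · simpa [Function.Injective, Fin.forall_fin_two, eq_comm] using hef
  · exact Fin.forall_fin_two.2 ⟨he, hf.symm⟩

lemma ncard_edgeSet_add_one_of_isTree (hV : V(G).Finite) (hE : E(G).Finite) (h : G.IsTree) :
    E(G).ncard + 1 = V(G).ncard := by
  obtain ⟨hconn, hac⟩ := h
  have hsimple : (simpleOn G E(G)).Connected :=
    simpleOn_connected hconn fun e x y h => simpleOn_reachable_of_isLink h.edge_mem h
  refine le_antisymm ?_ (ncard_vertexSet_le_of_simpleOn_connected hE hsimple)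
  have := hV.to_subtype
  have hlink : ∀ e : E(G), ∃ x y : V(G), G.IsLink e x y := fun e => by
    obtain ⟨x, y, h⟩ := G.exists_isLink_of_mem_edgeSet e.2
    exact ⟨⟨x, h.left_mem⟩, ⟨y, h.right_mem⟩, h⟩
  choose x y hl using hlink
  let toSimple (e : E(G)) : (simpleOn G E(G)).edgeSet :=
    ⟨s(x e, y e), fun hxy => ne_of_isLink_of_isAcyclic hac (hl e) (congrArg _ hxy), e, e.2, hl e⟩
  have hinj : Function.Injective toSimple := fun e f hef => by
    refine Subtype.ext (eq_of_isLink_of_isAcyclic hac (hl e) ?_)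
    rcases Sym2.eq_iff.1 (congrArg Subtype.val hef) with ⟨hx, hy⟩ | ⟨hx, hy⟩
    · rw [hx, hy]; exact hl f
    · rw [hx, hy]; exact (hl f).symm
  have : Finite (simpleOn G E(G)).edgeSet := inferInstance
  rw [← Nat.card_coe_set_eq, ← Nat.card_coe_set_eq V(G),
    ← (SimpleGraph.isTree_iff_connected_and_card.1 ⟨hsimple, simpleOn_isAcyclic hac _⟩).2]
  exact Nat.add_le_add_right (Nat.card_le_card_of_injective toSimple hinj) 1

lemma ncard_internalNodes_add_ncard_leaves (hV : V(G).Finite) (h13 : G.IsOneThree) :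
    G.internalNodes.ncard + (leaves G).ncard = V(G).ncard := by
  have hunion : G.internalNodes ∪ leaves G = V(G) := by
    ext v
    exact ⟨fun h => h.elim And.left And.left, fun hv => (h13 v hv).elim (fun h => .inr ⟨hv, h⟩)
      fun h => .inl ⟨hv, h⟩⟩
  rw [← hunion, Set.ncard_union_eq (Set.disjoint_left.2 fun v h1 h3 => by
    have := h1.2.symm.trans h3.2; omega) (hV.subset (internalNodes_subset G))
    (hV.subset (leaves_subset G))]

lemma three_mul_ncard_internalNodes_add_ncard_leaves (hV : V(G).Finite) (hE : E(G).Finite)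
    (h13 : G.IsOneThree) : 3 * G.internalNodes.ncard + (leaves G).ncard = 2 * E(G).ncard := by
  classical
  have := hV.fintype
  have := hE.fintype
  have hdeg (v : V(G)) : G.degree v =
      3 * (if (v : α) ∈ G.internalNodes then 1 else 0) + if (v : α) ∈ leaves G then 1 else 0 := by
    rcases h13 v v.2 with h | h <;> simp [Graph.internalNodes, leaves, h]
  rw [Set.ncard_eq_toFinset_card' E(G), Set.toFinset_card, ← sum_degree]
  simp only [hdeg, sum_add_distrib, ← mul_sum, ← card_filter]
  rw [card_filter_mem_eq_ncard (internalNodes_subset G),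
    card_filter_mem_eq_ncard (leaves_subset G)]

end Counting

/-! ### Lattice points as labelings -/

section LatticePoints

variable {α β : Type*} {G : Graph α β}

section EdgesAt

lemma edgesAt_swap {v : α} {a b c : E(G)} (h : G.EdgesAt v a b c) : G.EdgesAt v b a c := by
  classical
  exact fun e => (congrArg (· + _) (add_comm _ _)).trans (h e)

lemma edgesAt_rotate {v : α} {a b c : E(G)} (h : G.EdgesAt v a b c) : G.EdgesAt v c a b := by
  classical
  exact fun e => ((add_assoc _ _ _).trans (add_comm _ _)).trans (h e)

variable [Finite E(G)]

lemma exists_edgesAt {v : α} (hv : v ∈ G.internalNodes) : ∃ a b c, G.EdgesAt v a b c := by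
  have := Fintype.ofFinite E(G)
  simp only [edgesAt_iff_vertexStar_eq]
  exact Multiset.card_eq_three.1 ((card_vertexStar v).trans hv.2)

lemma exists_edgesAt_of_inc {v : α} (hv : v ∈ G.internalNodes) {e : E(G)} (he : G.Inc e v) :
    ∃ b c, G.EdgesAt v e b c := by
  classical
  obtain ⟨a, b, c, h⟩ := exists_edgesAt hv
  have hmem : e = a ∨ e = b ∨ e = c := by
    by_contra! hne
    have := h e
    simp only [if_neg hne.1, if_neg hne.2.1, if_neg hne.2.2, if_pos he] at this
    omega
  obtain rfl | rfl | rfl := hmem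
  exacts [⟨b, c, h⟩, ⟨a, c, edgesAt_swap h⟩, ⟨a, b, edgesAt_rotate h⟩]

lemma eq_of_inc_leaf {v : α} (hv : v ∈ leaves G) {e f : E(G)} (he : G.Inc e v) (hf : G.Inc f v) :
    e = f := by
  classical
  have := Fintype.ofFinite E(G)
  obtain ⟨a, ha⟩ := Multiset.card_eq_one.1 ((card_vertexStar v).trans hv.2)
  have heq (g : E(G)) (hg : G.Inc g v) : g = a := by
    by_contra hne
    have := count_vertexStar v g
    rw [ha, Multiset.count_singleton, if_neg hne, incMult, if_pos hg] at this
    omega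
  rw [heq e he, heq f hf]

lemma exists_edgesAt_or_isEdgeComponent (h13 : G.IsOneThree) (e : E(G)) :
    (∃ v ∈ G.internalNodes, ∃ b c, G.EdgesAt v e b c) ∨ G.IsEdgeComponent e := by
  by_contra! h
  obtain ⟨hint, hcomp⟩ := h
  refine hcomp fun f x he hf => ?_
  have hx : x ∈ leaves G := ⟨he.vertex_mem, (h13 x he.vertex_mem).resolve_right fun h3 => by
    obtain ⟨b, c, hbc⟩ := exists_edgesAt_of_inc ⟨he.vertex_mem, h3⟩ he
    exact hint x ⟨he.vertex_mem, h3⟩ b c hbc⟩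
  exact congrArg Subtype.val (eq_of_inc_leaf hx (e := ⟨f, hf.edge_mem⟩) hf he)

end EdgesAt

lemma mem_smul_polytopeP_iff [Finite E(G)] (h13 : G.IsOneThree) {t : ℝ} (ht : 0 ≤ t)
    (y : E(G) → ℝ) : y ∈ t • G.polytopeP ↔
      (∀ v ∈ G.internalNodes, ∀ a b c, G.EdgesAt v a b c → TriangleLe t (y a) (y b) (y c)) ∧
        ∀ e, G.IsEdgeComponent e → 0 ≤ y e ∧ y e ≤ t / 2 := by
  obtain rfl | ht := ht.eq_or_lt
  · have hne : G.polytopeP.Nonempty := ⟨0, by simp [Graph.polytopeP]⟩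
    rw [Set.zero_smul_set hne, Set.mem_zero]
    refine ⟨by rintro rfl; simp [TriangleLe], fun ⟨hint, hcomp⟩ => funext fun e => ?_⟩
    change y e = 0
    rcases exists_edgesAt_or_isEdgeComponent h13 e with ⟨v, hv, b, c, h⟩ | h
    · obtain ⟨h1, h2, h3, h4⟩ := hint v hv e b c h
      linarith
    · obtain ⟨h1, h2⟩ := hcomp e h
      linarith
  · rw [Set.mem_smul_set_iff_inv_smul_mem₀ ht.ne']
    simp only [Graph.polytopeP, Set.mem_ofPred_eq, Pi.smul_apply, smul_eq_mul, ← mul_add,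
      TriangleLe, inv_mul_le_iff₀ ht, mul_inv_cancel_left₀ ht.ne', mul_one, mul_one_div,
      mul_nonneg_iff_of_pos_left (inv_pos.2 ht)]

lemma mem_smul_polytopeQ_iff [Finite E(G)] (h13 : G.IsOneThree) {t : ℝ} (ht : 0 ≤ t)
    (y : E(G) ⊕ G.internalNodes → ℝ) : y ∈ t • G.polytopeQ ↔
      (∀ v : G.internalNodes, ∀ a b c, G.EdgesAt v a b c →
        TriangleLe (2 * t) (y (.inl a)) (y (.inl b)) (y (.inl c)) ∧
          y (.inl a) + y (.inl b) + y (.inl c) = 2 * y (.inr v)) ∧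
        ∀ e, G.IsEdgeComponent e → 0 ≤ y (.inl e) ∧ y (.inl e) ≤ t := by
  obtain rfl | ht := ht.eq_or_lt
  · have hne : G.polytopeQ.Nonempty := ⟨0, by simp [Graph.polytopeQ]⟩
    rw [Set.zero_smul_set hne, Set.mem_zero]
    refine ⟨by rintro rfl; simp [TriangleLe], fun ⟨hint, hcomp⟩ => funext fun i => ?_⟩
    change y i = 0
    obtain e | v := i
    · rcases exists_edgesAt_or_isEdgeComponent h13 e with ⟨v, hv, b, c, h⟩ | h
      · obtain ⟨⟨h1, h2, h3, h4⟩, -⟩ := hint ⟨v, hv⟩ e b c h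
        linarith
      · obtain ⟨h1, h2⟩ := hcomp e h
        linarith
    · obtain ⟨a, b, c, h⟩ := exists_edgesAt v.2
      obtain ⟨⟨h1, h2, h3, h4⟩, h5⟩ := hint v a b c h
      linarith
  · rw [Set.mem_smul_set_iff_inv_smul_mem₀ ht.ne']
    simp only [Graph.polytopeQ, Set.mem_ofPred_eq, Pi.smul_apply, smul_eq_mul, ← mul_add,
      TriangleLe, mul_left_comm (2 : ℝ) t⁻¹, mul_right_inj' (inv_ne_zero ht.ne'),
      inv_mul_le_iff₀ ht, mul_inv_cancel_left₀ ht.ne', mul_one,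
      mul_nonneg_iff_of_pos_left (inv_pos.2 ht)]
    refine and_congr_left' (forall_congr' fun v => forall₃_congr fun a b c =>
      imp_congr_right fun _ => ?_)
    constructor <;> rintro ⟨⟩ <;> grind

lemma ncard_eq_of_forall_mem_Ico {ι : Type*} {n : ℕ} {S : Set (ι → ℤ)} {T : Set (ι → Fin n)}
    (hS : ∀ z ∈ S, ∀ i, z i ∈ Set.Ico 0 (n : ℤ))
    (h : ∀ w : ι → Fin n, (fun i => ((w i : ℕ) : ℤ)) ∈ S ↔ w ∈ T) : S.ncard = T.ncard := by
  have hinj : Function.Injective fun (w : ι → Fin n) i => ((w i : ℕ) : ℤ) := fun w w' hw =>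
    funext fun i => Fin.ext (Nat.cast_injective (congrFun hw i))
  rw [← Set.ncard_image_of_injective T hinj]
  congr 1
  ext z
  refine ⟨fun hz => ?_, by rintro ⟨w, hw, rfl⟩; exact (h w).2 hw⟩
  have hz' (i : ι) : ((z i).toNat : ℤ) = z i := Int.toNat_of_nonneg (hS z hz i).1
  refine ⟨fun i => ⟨(z i).toNat, by have := (hS z hz i).2; have := hz' i; omega⟩, ?_, funext hz'⟩
  rw [← h]
  simpa only [hz'] using hz

theorem ehrhart_polytopeP [Finite E(G)] (h13 : G.IsOneThree) (t : ℕ) :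
    ehrhart G.polytopeP t = (labelings G (soFusionRule t).rule).ncard := by
  have hcast (z : E(G) → ℤ) : (fun e => (z e : ℝ)) ∈ (t : ℝ) • G.polytopeP ↔
      (∀ v ∈ G.internalNodes, ∀ a b c, G.EdgesAt v a b c →
        TriangleLe (t : ℤ) (z a) (z b) (z c)) ∧
        ∀ e, G.IsEdgeComponent e → 0 ≤ z e ∧ z e * 2 ≤ t := by
    rw [mem_smul_polytopeP_iff h13 t.cast_nonneg]
    simp only [TriangleLe, le_div_iff₀ (zero_lt_two (α := ℝ))]
    norm_cast
  refine ncard_eq_of_forall_mem_Ico (fun z hz e => ?_) fun w => ?_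
  · obtain ⟨hint, hcomp⟩ := (hcast z).1 hz
    rw [Set.mem_Ico]
    rcases exists_edgesAt_or_isEdgeComponent h13 e with ⟨v, hv, b, c, h⟩ | h
    · obtain ⟨h1, h2, h3, h4⟩ := hint v hv e b c h
      omega
    · obtain ⟨h1, h2⟩ := hcomp e h
      omega
  · refine (hcast _).trans ((and_iff_left fun e _ => ?_).trans ?_)
    · have := (w e).isLt
      omega
    · simp only [labelings, soFusionRule, TriangleLe, Set.mem_ofPred_eq]
      norm_cast

lemma sum_eq_of_edgesAt [Finite E(G)] {v : α} {a b c a' b' c' : E(G)} (h : G.EdgesAt v a b c)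
    (h' : G.EdgesAt v a' b' c') {M : Type*} [AddCommMonoid M] (f : E(G) → M) :
    f a + f b + f c = f a' + f b' + f c' := by
  have := Fintype.ofFinite E(G)
  have hstar : ({a, b, c} : Multiset E(G)) = {a', b', c'} :=
    (edgesAt_iff_vertexStar_eq.1 h).symm.trans (edgesAt_iff_vertexStar_eq.1 h')
  simpa [add_assoc] using congrArg (fun s => (s.map f).sum) hstar

lemma ehrhart_polytopeQ_eq_ncard [Finite E(G)] (h13 : G.IsOneThree) (t : ℕ) :
    ehrhart G.polytopeQ t = {z : E(G) → ℤ |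
      (∀ v ∈ G.internalNodes, ∀ a b c, G.EdgesAt v a b c →
        TriangleLe (2 * t : ℤ) (z a) (z b) (z c) ∧ Even (z a + z b + z c)) ∧
        ∀ e, G.IsEdgeComponent e → 0 ≤ z e ∧ z e ≤ t}.ncard := by
  have hcast (y : E(G) ⊕ G.internalNodes → ℤ) : (fun i => (y i : ℝ)) ∈ (t : ℝ) • G.polytopeQ ↔
      (∀ v : G.internalNodes, ∀ a b c, G.EdgesAt v a b c →
        TriangleLe (2 * t : ℤ) (y (.inl a)) (y (.inl b)) (y (.inl c)) ∧
          y (.inl a) + y (.inl b) + y (.inl c) = 2 * y (.inr v)) ∧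
        ∀ e, G.IsEdgeComponent e → 0 ≤ y (.inl e) ∧ y (.inl e) ≤ t := by
    rw [mem_smul_polytopeQ_iff h13 t.cast_nonneg]
    simp only [TriangleLe]
    norm_cast
  choose a b c habc using fun v : G.internalNodes => exists_edgesAt v.2
  refine Set.ncard_congr (fun y _ e => y (.inl e)) (fun y hy => ?_) (fun y y' hy hy' h => ?_)
    fun z hz => ?_
  · obtain ⟨hint, hcomp⟩ := (hcast y).1 hy
    exact ⟨fun v hv a b c h => (hint ⟨v, hv⟩ a b c h).imp_right fun h => ⟨_, h.trans (two_mul _)⟩,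
      hcomp⟩
  · have hinl (e : E(G)) : y (.inl e) = y' (.inl e) := congrFun h e
    funext i
    obtain e | v := i
    · exact hinl e
    · have hv := (((hcast y).1 hy).1 v _ _ _ (habc v)).2
      rw [hinl, hinl, hinl, (((hcast y').1 hy').1 v _ _ _ (habc v)).2] at hv
      omega
  · refine ⟨Sum.elim z fun v => (z (a v) + z (b v) + z (c v)) / 2,
      (hcast _).2 ⟨fun v a' b' c' h => ?_, hz.2⟩, rfl⟩
    obtain ⟨htriangle, heven⟩ := hz.1 v v.2 a' b' c' h
    simp only [Sum.elim_inl, Sum.elim_inr, sum_eq_of_edgesAt (habc v) h z]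
    exact ⟨htriangle, by rw [Int.mul_ediv_cancel' heven.two_dvd]⟩

theorem ehrhart_polytopeQ [Finite E(G)] (h13 : G.IsOneThree) (t : ℕ) :
    ehrhart G.polytopeQ t = (labelings G (suFusionRule t).rule).ncard := by
  rw [ehrhart_polytopeQ_eq_ncard h13]
  refine ncard_eq_of_forall_mem_Ico (fun z hz e => ?_) fun w => ?_
  · rw [Set.mem_Ico]
    rcases exists_edgesAt_or_isEdgeComponent h13 e with ⟨v, hv, b, c, h⟩ | h
    · obtain ⟨⟨h1, h2, h3, h4⟩, -⟩ := hz.1 v hv e b c h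
      omega
    · obtain ⟨h1, h2⟩ := hz.2 e h
      omega
  · refine (and_iff_left fun e _ => ⟨by positivity, Int.ofNat_le.2 (w e).is_le⟩).trans ?_
    simp only [labelings, suFusionRule, EvenTriangleLe, TriangleLe, Set.mem_ofPred_eq]
    norm_cast

open Classical in
lemma degree_restrict [Finite E(G)] (S : Set β) {v : α} {a b c : E(G)} (h : G.EdgesAt v a b c) :
    (G.restrict S).degree v = (if (a : β) ∈ S then 1 else 0) + (if (b : β) ∈ S then 1 else 0) +
      if (c : β) ∈ S then 1 else 0 := by
  have := Fintype.ofFinite E(G)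
  have hsum := sum_map_vertexStar v fun e : E(G) => if (e : β) ∈ S then 1 else 0
  rw [edgesAt_iff_vertexStar_eq.1 h] at hsum
  have hmult (e : E(G)) : incMult (G.restrict S) v e =
      incMult G v e • if (e : β) ∈ S then 1 else 0 := by
    by_cases he : (e : β) ∈ S <;> simp [incMult, he]
  rw [degree_eq_sum_incMult (F := E(G)) (by simp), sum_congr rfl fun e _ => hmult e, ← hsum]
  simp [add_assoc]

open Classical in
lemma indicator_mem_labelings_iff [Finite E(G)] (S : Set β) :
    (fun e : E(G) => if (e : β) ∈ S then 1 else 0) ∈ labelings G parityFusionRule.rule ↔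
      ∀ v ∈ G.internalNodes, (G.restrict S).degree v = 0 ∨ (G.restrict S).degree v = 2 := by
  have hdeg (v : α) (a b c : E(G)) (h : G.EdgesAt v a b c) :
      parityFusionRule.rule (if (a : β) ∈ S then 1 else 0) (if (b : β) ∈ S then 1 else 0)
        (if (c : β) ∈ S then 1 else 0) ↔
        (G.restrict S).degree v = 0 ∨ (G.restrict S).degree v = 2 := by
    rw [degree_restrict S h]
    simp only [parityFusionRule]
    split_ifs <;> decide
  refine forall₂_congr fun v hv => ⟨fun h => ?_, fun h a b c habc => (hdeg v a b c habc).2 h⟩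
  obtain ⟨a, b, c, habc⟩ := exists_edgesAt hv
  exact (hdeg v a b c habc).1 (h a b c habc)

theorem numInternallyEulerian_eq_ncard_labelings [Finite E(G)] :
    G.numInternallyEulerian = (labelings G parityFusionRule.rule).ncard := by
  classical
  refine Set.ncard_congr (fun S _ e => if (e : β) ∈ S then 1 else 0)
    (fun S hS => (indicator_mem_labelings_iff S).2 hS.2) (fun S T hS hT h => ?_) fun w hw => ?_
  · ext e
    by_cases he : e ∈ E(G)
    · have := congrFun h ⟨e, he⟩
      by_cases h1 : e ∈ S <;> by_cases h2 : e ∈ T <;> simp_all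
    · exact iff_of_false (fun h => he (hS.1 h)) fun h => he (hT.1 h)
  · have hw01 : (fun e : E(G) => if (e : β) ∈ Subtype.val '' {e | w e = 1} then 1 else 0) = w := by
      funext e
      by_cases he : w e = 1
      · simp [he]
      · simp [show w e = 0 by omega]
    refine ⟨Subtype.val '' {e | w e = 1}, ⟨Subtype.coe_image_subset _ _, ?_⟩, hw01⟩
    rwa [← indicator_mem_labelings_iff, hw01]

end LatticePoints

/-! ### Power sums of cosecants are polynomials -/

section PowerSums

open Polynomial

lemma exists_polynomial_sum_range {R : Type*} [CommRing R] [Algebra ℚ R] (P : R[X]) :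
    ∃ Q : R[X], ∀ n : ℕ, ∑ k ∈ range n, P.eval (k : R) = n * Q.eval (n : R) := by
  suffices h : ∃ Q : R[X], Q.eval 0 = 0 ∧ ∀ n : ℕ, ∑ k ∈ range n, P.eval (k : R) = Q.eval (n : R) by
    obtain ⟨Q, hQ0, hQ⟩ := h
    obtain ⟨Q', rfl⟩ := X_dvd_iff.2 ((coeff_zero_eq_eval_zero Q).trans hQ0)
    exact ⟨Q', fun n => by rw [hQ, eval_mul, eval_X]⟩
  induction P using Polynomial.induction_on' with
  | add P₁ P₂ h₁ h₂ =>
    obtain ⟨Q₁, h₁0, h₁⟩ := h₁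
    obtain ⟨Q₂, h₂0, h₂⟩ := h₂
    exact ⟨Q₁ + Q₂, by rw [eval_add, h₁0, h₂0, add_zero],
      fun n => by simp only [eval_add, sum_add_distrib, h₁, h₂]⟩
  | monomial d r =>
    let faulhaber : ℚ[X] :=
      C ((d + 1 : ℚ)⁻¹) * (Polynomial.bernoulli (d + 1) - C (_root_.bernoulli (d + 1)))
    have hsum (n : ℕ) : faulhaber.eval (n : ℚ) = ∑ k ∈ range n, (k : ℚ) ^ d := by
      rw [eval_mul, eval_C, eval_sub, eval_C, ← Nat.succ_eq_add_one,
        ← sum_range_pow_eq_bernoulli_sub, inv_mul_cancel_left₀ (by positivity)]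
    refine ⟨C r * faulhaber.map (algebraMap ℚ R), ?_, fun n => ?_⟩
    · have h0 := eval_natCast_map (algebraMap ℚ R) faulhaber 0
      rw [hsum, range_zero, sum_empty, map_zero, Nat.cast_zero] at h0
      rw [eval_mul, h0, mul_zero]
    · simp only [eval_monomial, ← mul_sum, eval_mul, eval_C, eval_natCast_map, hsum, map_sum,
        map_pow, map_natCast]

/-- The power sum `∑ csc(jπ / n) ^ (2m)` over `0 < j < n`. -/
noncomputable def cscSum (m n : ℕ) : ℝ := ∑ j ∈ Ico 1 n, ((Real.sin (j * π / n) ^ 2)⁻¹) ^ m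

/-- The sum `∑ sin(a jπ / n)² csc(jπ / n) ^ (2m)` over `0 < j < n`. In `a` it satisfies a second
order difference equation that lowers `m`. -/
noncomputable def sinSqCscSum (m n a : ℕ) : ℝ :=
  ∑ j ∈ Ico 1 n, Real.sin (a * (j * π / n)) ^ 2 * ((Real.sin (j * π / n) ^ 2)⁻¹) ^ m

lemma sum_range_sin_sq {n : ℕ} {a : ℕ} (ha : 0 < a) (han : a < n) :
    ∑ j ∈ range n, Real.sin (a * (j * π / n)) ^ 2 = n / 2 := by
  have h := sum_range_sin_mul_sin n a a
  have hdvd : ¬ (2 * n : ℤ) ∣ a + a := fun h => by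
    have := Int.le_of_dvd (by omega) h
    omega
  rw [sub_self, if_pos (dvd_zero _), if_neg hdvd] at h
  simpa [sq] using h

lemma sinSqCscSum_zero {n a : ℕ} (ha : 0 < a) (han : a < n) : sinSqCscSum 0 n a = n / 2 := by
  rw [sinSqCscSum, ← sum_range_sin_sq ha han]
  simp only [pow_zero, mul_one]
  exact sum_Ico_one_eq_sum_range (f := fun j => Real.sin (a * (j * π / n)) ^ 2) (by simp) n

lemma sinSqCscSum_succ_add_two (m n a : ℕ) :
    sinSqCscSum (m + 1) n (a + 2) - 2 * sinSqCscSum (m + 1) n (a + 1) + sinSqCscSum (m + 1) n a =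
      2 * cscSum m n - 4 * sinSqCscSum m n (a + 1) := by
  simp only [sinSqCscSum, cscSum, mul_sum, ← sum_sub_distrib, ← sum_add_distrib]
  refine sum_congr rfl fun j hj => ?_
  obtain ⟨hj, hjn⟩ := mem_Ico.1 hj
  have hsin := (sin_nat_mul_pi_div_pos hj hjn).ne'
  set x := j * π / n
  have hdiff : Real.sin ((a + 2 : ℕ) * x) ^ 2 - 2 * Real.sin ((a + 1 : ℕ) * x) ^ 2 +
      Real.sin (a * x) ^ 2 = (2 - 4 * Real.sin ((a + 1 : ℕ) * x) ^ 2) * Real.sin x ^ 2 := by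
    have h2 : Real.sin ((a + 2 : ℕ) * x) = Real.sin ((a + 1 : ℕ) * x + x) := by
      push_cast; ring_nf
    have h0 : Real.sin (a * x) = Real.sin ((a + 1 : ℕ) * x - x) := by push_cast; ring_nf
    rw [h2, h0, Real.sin_add, Real.sin_sub]
    linear_combination 2 * Real.sin ((a + 1 : ℕ) * x) ^ 2 * Real.sin_sq_add_cos_sq x +
      2 * Real.sin x ^ 2 * Real.sin_sq_add_cos_sq ((a + 1 : ℕ) * x)
  rw [pow_succ]
  linear_combination ((Real.sin x ^ 2)⁻¹ ^ m * (Real.sin x ^ 2)⁻¹) * hdiff +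
    (2 - 4 * Real.sin ((a + 1 : ℕ) * x) ^ 2) * (Real.sin x ^ 2)⁻¹ ^ m *
      inv_mul_cancel₀ (pow_ne_zero 2 hsin)

lemma sinSqCscSum_right_zero (m n : ℕ) : sinSqCscSum m n 0 = 0 := by simp [sinSqCscSum]

lemma sinSqCscSum_succ_one (m n : ℕ) : sinSqCscSum (m + 1) n 1 = cscSum m n := by
  refine sum_congr rfl fun j hj => ?_
  obtain ⟨hj, hjn⟩ := mem_Ico.1 hj
  have hsin := (sin_nat_mul_pi_div_pos hj hjn).ne'
  rw [Nat.cast_one, one_mul, pow_succ' (_ ^ 2)⁻¹ m, mul_inv_cancel_left₀ (pow_ne_zero 2 hsin)]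

lemma sum_sinSqCscSum (m n : ℕ) : ∑ a ∈ range n, sinSqCscSum m n a = n / 2 * cscSum m n := by
  simp only [sinSqCscSum, cscSum, mul_sum]
  rw [sum_comm]
  refine sum_congr rfl fun j hj => ?_
  obtain ⟨hj, hjn⟩ := mem_Ico.1 hj
  rw [← sum_mul, ← sum_range_sin_sq hj hjn]
  congr! 4 with a
  ring

lemma sinSqCscSum_succ_eq_sum (m n a : ℕ) : sinSqCscSum (m + 1) n a =
    ∑ b ∈ range a, (cscSum m n +
      ∑ c ∈ range b, (2 * cscSum m n - 4 * sinSqCscSum m n (c + 1))) := by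
  have hdiff (b : ℕ) : sinSqCscSum (m + 1) n (b + 1) - sinSqCscSum (m + 1) n b =
      cscSum m n + ∑ c ∈ range b, (2 * cscSum m n - 4 * sinSqCscSum m n (c + 1)) := by
    induction b with
    | zero => simp [sinSqCscSum_right_zero, sinSqCscSum_succ_one]
    | succ b ih =>
      rw [sum_range_succ, ← add_assoc, ← ih, ← sinSqCscSum_succ_add_two]
      ring
  rw [sum_congr rfl fun b _ => (hdiff b).symm, sum_range_sub, sinSqCscSum_right_zero, sub_zero]

lemma exists_polynomial_sinSqCscSum_succ {m : ℕ} {S : ℝ[X]} {F : ℝ[X][X]}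
    (hS : ∀ n : ℕ, 0 < n → cscSum m n = S.eval (n : ℝ))
    (hF : ∀ n a : ℕ, 0 < a → a < n → sinSqCscSum m n a = (F.eval (a : ℝ[X])).eval (n : ℝ)) :
    ∃ F' : ℝ[X][X], ∀ n a : ℕ, a < n →
      sinSqCscSum (m + 1) n a = (F'.eval (a : ℝ[X])).eval (n : ℝ) := by
  obtain ⟨F₁, hF₁⟩ := exists_polynomial_sum_range (C (2 * S) - 4 * F.comp (X + 1))
  obtain ⟨F₂, hF₂⟩ := exists_polynomial_sum_range (C S + X * F₁)
  refine ⟨X * F₂, fun n a han => ?_⟩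
  have hinner (b : ℕ) (hb : b < a) :
      ∑ c ∈ range b, (2 * cscSum m n - 4 * sinSqCscSum m n (c + 1)) =
        ((X * F₁).eval (b : ℝ[X])).eval (n : ℝ) := by
    rw [eval_mul, eval_X, ← hF₁, eval_finsetSum]
    refine sum_congr rfl fun c hc => ?_
    have hc := mem_range.1 hc
    rw [hS n (by omega), hF n (c + 1) (by omega) (by omega)]
    simp [eval_comp]
  rw [sinSqCscSum_succ_eq_sum, eval_mul, eval_X, ← hF₂, eval_finsetSum]
  refine sum_congr rfl fun b hb => ?_
  rw [hinner b (mem_range.1 hb), hS n (by omega), eval_add, eval_C, eval_add]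

theorem exists_polynomial_cscSum (m : ℕ) :
    ∃ S : ℝ[X], ∀ n : ℕ, 0 < n → cscSum m n = S.eval (n : ℝ) := by
  suffices h : ∃ (S : ℝ[X]) (F : ℝ[X][X]), (∀ n : ℕ, 0 < n → cscSum m n = S.eval (n : ℝ)) ∧
      ∀ n a : ℕ, 0 < a → a < n → sinSqCscSum m n a = (F.eval (a : ℝ[X])).eval (n : ℝ) from
    h.imp fun S ⟨_, hS, _⟩ => hS
  induction m with
  | zero =>
    refine ⟨X - 1, C (C (1 / 2) * X), fun n hn => ?_, fun n a ha han => ?_⟩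
    · simp [cscSum, Nat.cast_sub hn]
    · rw [sinSqCscSum_zero ha han]
      simp [div_eq_inv_mul]
  | succ m ih =>
    obtain ⟨S, F, hS, hF⟩ := ih
    obtain ⟨F', hF'⟩ := exists_polynomial_sinSqCscSum_succ hS hF
    obtain ⟨Q, hQ⟩ := exists_polynomial_sum_range F'
    refine ⟨2 * Q.eval X, F', fun n hn => ?_, fun n a _ han => hF' n a han⟩
    have hn' : (n : ℝ) ≠ 0 := Nat.cast_ne_zero.2 hn.ne'
    have hsum : (n : ℝ) / 2 * cscSum (m + 1) n = n * (Q.eval X).eval (n : ℝ) := by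
      rw [← sum_sinSqCscSum, sum_congr rfl fun a ha => hF' n a (mem_range.1 ha),
        ← eval_finsetSum, hQ, eval_mul, eval_natCast, ← coe_evalRingHom, ← eval₂_at_apply,
        ← eval₂_at_apply, coe_evalRingHom, eval_natCast, eval_X]
    rw [eval_mul, eval_ofNat]
    field_simp at hsum
    linarith

lemma sum_Ico_one_two_mul_even {M : Type*} [AddCommMonoid M] (f : ℕ → M) (n : ℕ) :
    ∑ j ∈ Ico 1 (2 * n) with Even j, f j = ∑ k ∈ Ico 1 n, f (2 * k) := by
  symm
  refine sum_nbij' (2 * ·) (· / 2) ?_ ?_ ?_ ?_ ?_ <;>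
    simp only [mem_filter, mem_Ico, Nat.even_iff, implies_true] <;> omega

lemma sum_Ico_one_two_mul_of_periodic {M : Type*} [AddCommMonoid M] {f : ℕ → M} {n : ℕ}
    (hn : Odd n) (hf : f.Periodic n) : ∑ k ∈ Ico 1 n, f (2 * k) = ∑ j ∈ Ico 1 n, f j := by
  rw [Nat.odd_iff] at hn
  refine sum_nbij' (fun k => if 2 * k < n then 2 * k else 2 * k - n)
    (fun j => if j % 2 = 0 then j / 2 else (j + n) / 2) ?_ ?_ ?_ ?_ ?_ <;>
    simp only [mem_Ico] <;> intro k hk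
  iterate 4 split_ifs <;> omega
  split_ifs with h
  · rfl
  · rw [← hf (2 * k - n), Nat.sub_add_cancel (by omega)]

lemma cscSum_two_mul (m n : ℕ) : cscSum m (2 * n) = cscSum m n +
    ∑ j ∈ Ico 1 (2 * n) with Odd j, ((Real.sin (j * π / (2 * n : ℕ)) ^ 2)⁻¹) ^ m := by
  have heven (k : ℕ) : ((2 * k : ℕ) : ℝ) * π / (2 * n : ℕ) = k * π / n := by
    push_cast
    rw [mul_assoc, mul_div_mul_left _ _ two_ne_zero]
  simp only [cscSum, ← heven, ← Nat.not_even_iff_odd]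
  rw [← sum_Ico_one_two_mul_even fun j => ((Real.sin (j * π / (2 * n : ℕ)) ^ 2)⁻¹) ^ m,
    sum_filter_add_sum_filter_not]

/-- The power sum `∑ csc(jπ / n) ^ (2p) * sec(jπ / n) ^ (2q)` over `0 < j < n`, for odd `n`. -/
noncomputable def cscSecSum (p q n : ℕ) : ℝ :=
  ∑ j ∈ Ico 1 n, ((Real.sin (j * π / n) ^ 2)⁻¹) ^ p * ((Real.cos (j * π / n) ^ 2)⁻¹) ^ q

lemma cscSecSum_zero_right (p n : ℕ) : cscSecSum p 0 n = cscSum p n := by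
  simp [cscSecSum, cscSum]

/-- The secants at `jπ / n` are, up to sign, the cosecants at the odd multiples of `π / (2n)`. -/
lemma cscSecSum_zero_left {n : ℕ} (hn : Odd n) (q : ℕ) :
    cscSecSum 0 q n = cscSum q (2 * n) - cscSum q n - 1 := by
  have hn0 : (n : ℝ) ≠ 0 := Nat.cast_ne_zero.2 hn.pos.ne'
  have hmid : ((Real.sin (n * π / (2 * n : ℕ)) ^ 2)⁻¹) ^ q = 1 := by
    rw [show (n : ℝ) * π / (2 * n : ℕ) = π / 2 by push_cast; field_simp, Real.sin_pi_div_two]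
    simp
  have hmem : n ∈ {j ∈ Ico 1 (2 * n) | Odd j} := by
    simp only [mem_filter, mem_Ico]
    exact ⟨⟨hn.pos, by have := hn.pos; omega⟩, hn⟩
  rw [cscSum_two_mul, ← sum_erase_add _ _ hmem, add_sub_cancel_left, hmid,
    add_sub_cancel_right, cscSecSum]
  rw [Nat.odd_iff] at hn
  refine sum_nbij' (fun k => if 2 * k < n then 2 * k + n else 2 * k - n)
    (fun j => if n < j then (j - n) / 2 else (j + n) / 2) ?_ ?_ ?_ ?_ ?_ <;>
    simp only [mem_erase, mem_filter, mem_Ico, Nat.odd_iff] <;> intro k hk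
  iterate 4 split_ifs <;> omega
  rw [pow_zero, one_mul]
  split_ifs with h
  · rw [show ((2 * k + n : ℕ) : ℝ) * π / (2 * n : ℕ) = k * π / n + π / 2 by push_cast; field_simp,
      Real.sin_add_pi_div_two]
  · have hangle : ((2 * k - n : ℕ) : ℝ) * π / (2 * n : ℕ) = k * π / n - π / 2 := by
      push_cast [Nat.cast_sub (show n ≤ 2 * k by omega)]
      field_simp
    rw [hangle, Real.sin_sub_pi_div_two, neg_sq]

lemma cos_nat_mul_pi_div_ne_zero {n : ℕ} (hn : Odd n) {j : ℕ} (hj : 0 < j) (hjn : j < n) :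
    Real.cos (j * π / n) ≠ 0 := by
  have hndvd : ¬ (n : ℤ) ∣ (2 * j : ℕ) := fun h =>
    Nat.not_dvd_of_pos_of_lt hj hjn
      ((Nat.coprime_two_right.2 hn).dvd_of_dvd_mul_left (Int.natCast_dvd_natCast.1 h))
  have hsin := (sin_int_mul_pi_div_eq_zero_iff hn.pos.ne').not.2 hndvd
  push_cast at hsin
  rw [mul_assoc, mul_div_assoc, Real.sin_two_mul] at hsin
  exact right_ne_zero_of_mul hsin

lemma cscSecSum_succ_succ {n : ℕ} (hn : Odd n) (p q : ℕ) :
    cscSecSum (p + 1) (q + 1) n = cscSecSum p (q + 1) n + cscSecSum (p + 1) q n := by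
  simp only [cscSecSum, ← sum_add_distrib]
  refine sum_congr rfl fun j hj => ?_
  obtain ⟨hj, hjn⟩ := mem_Ico.1 hj
  have hsin := (sin_nat_mul_pi_div_pos hj hjn).ne'
  have hcos := cos_nat_mul_pi_div_ne_zero hn hj hjn
  have hsum := Real.sin_sq_add_cos_sq (j * π / n)
  set x := j * π / n
  have hpartial : (Real.sin x ^ 2)⁻¹ * (Real.cos x ^ 2)⁻¹ =
      (Real.sin x ^ 2)⁻¹ + (Real.cos x ^ 2)⁻¹ := by
    field_simp
    rw [add_comm, hsum]
  rw [pow_succ, pow_succ]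
  linear_combination ((Real.sin x ^ 2)⁻¹ ^ p * (Real.cos x ^ 2)⁻¹ ^ q) * hpartial

lemma exists_polynomial_cscSecSum (p q : ℕ) :
    ∃ P : ℝ[X], ∀ n : ℕ, Odd n → cscSecSum p q n = P.eval (n : ℝ) := by
  induction p, q using Nat.pincerRecursion with
  | Ha0 p =>
    obtain ⟨S, hS⟩ := exists_polynomial_cscSum p
    exact ⟨S, fun n hn => by rw [cscSecSum_zero_right, hS n hn.pos]⟩
  | H0b q =>
    obtain ⟨S, hS⟩ := exists_polynomial_cscSum q
    refine ⟨S.comp (2 * X) - S - 1, fun n hn => ?_⟩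
    rw [cscSecSum_zero_left hn, hS _ (by have := hn.pos; omega), hS n hn.pos]
    simp
  | H p q hp hq =>
    obtain ⟨P, hP⟩ := hp
    obtain ⟨Q, hQ⟩ := hq
    exact ⟨P + Q, fun n hn => by rw [cscSecSum_succ_succ hn, hP n hn, hQ n hn, eval_add]⟩

end PowerSums

/-! ### Evaluation of the state sums -/

section StateSums

/-- The value at the class `jπ / n` of the sum of the characters of `SO(3)` at level `n - 2`. -/
noncomputable def soLeaf (n j : ℕ) : ℝ := ∑ a ∈ range (n / 2), sinChar (2 * a + 1) (j * π / n)

/-- The state sum of the `SO(3)` fusion rule at level `n - 2` on a connected graph with `l` leaves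
and Euler characteristic `-h`. -/
noncomputable def soSum (h : ℤ) (l n : ℕ) : ℝ :=
  ∑ j ∈ Ico 1 (n / 2 + 1), soNorm n j ^ h * soLeaf n j ^ l

lemma soLeaf_eq_div (n j : ℕ) : soLeaf n j =
    Real.sin ((n / 2 : ℕ) * (j * π / n)) ^ 2 / Real.sin (j * π / n) ^ 2 := sum_sinChar_odd _ _

lemma soLeaf_sub {n j : ℕ} (hj : j < n) : soLeaf n (n - j) = soLeaf n j := by
  simp only [soLeaf, ← pi_sub_nat_mul_pi_div hj, sinChar_odd_pi_sub]

lemma foldMult_sub {n j : ℕ} (hj : j ≤ n) : foldMult n (n - j) = foldMult n j :=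
  if_congr (by omega) rfl rfl

lemma two_pow_mul_soSum (g l n : ℕ) : 2 ^ g * soSum (g - 1) l n =
    ∑ j ∈ Ico 1 n, (2 / foldMult n j : ℝ) ^ g * (suNorm n j ^ (g - 1 : ℤ) * soLeaf n j ^ l) := by
  rw [sum_Ico_one_fold fun j _ hjn => by rw [foldMult_sub hjn.le, suNorm_sub hjn, soLeaf_sub hjn],
    soSum, mul_sum]
  refine sum_congr rfl fun j _ => ?_
  have hfold : (foldMult n j : ℝ) ≠ 0 := by rw [foldMult]; split_ifs <;> norm_num
  rw [soNorm, div_zpow, div_pow, zpow_sub_one₀ hfold, zpow_natCast]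
  field_simp

lemma two_pow_mul_soSum_of_odd {n : ℕ} (hn : Odd n) (g l : ℕ) :
    2 ^ g * soSum (g - 1) l n = ∑ j ∈ Ico 1 n, suNorm n j ^ (g - 1 : ℤ) * soLeaf n j ^ l := by
  rw [two_pow_mul_soSum]
  refine sum_congr rfl fun j _ => ?_
  rw [foldMult, if_neg fun h => Nat.not_even_iff_odd.2 hn ⟨j, by omega⟩, Nat.cast_two,
    div_self two_ne_zero, one_pow, one_mul]

lemma mul_pi_div_two_mul_self {n : ℕ} (hn : n ≠ 0) : (n : ℝ) * π / (2 * n : ℕ) = π / 2 := by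
  push_cast
  field_simp

lemma two_pow_mul_soSum_two_mul {n : ℕ} (hn : 0 < n) (g l : ℕ) :
    2 ^ g * soSum (g - 1) l (2 * n) =
      ∑ j ∈ Ico 1 (2 * n), suNorm (2 * n) j ^ (g - 1 : ℤ) * soLeaf (2 * n) j ^ l +
        (2 ^ g - 1) * (n ^ (g - 1 : ℤ) * soLeaf (2 * n) n ^ l) := by
  have hmid : n ∈ Ico 1 (2 * n) := mem_Ico.2 (by omega)
  have hnorm : suNorm (2 * n) n = n := by
    rw [suNorm, mul_pi_div_two_mul_self hn.ne', Real.sin_pi_div_two]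
    push_cast
    ring
  rw [two_pow_mul_soSum, ← sum_erase_add _ _ hmid,
    ← sum_erase_add _ (fun j => suNorm _ j ^ _ * _) hmid,
    hnorm, foldMult, if_pos rfl, sum_congr rfl fun j hj => ?_]
  · push_cast
    ring
  · have := ne_of_mem_erase hj
    rw [foldMult, if_neg (by omega), Nat.cast_two, div_self two_ne_zero, one_pow, one_mul]

lemma soLeaf_two_mul (n j : ℕ) (hn : n ≠ 0) : soLeaf (2 * n) j =
    if Odd j then (Real.sin (j * π / (2 * n : ℕ)) ^ 2)⁻¹ else 0 := by
  have hangle : (n : ℝ) * (j * π / (2 * n : ℕ)) = j * (π / 2) := by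
    push_cast
    field_simp
  rw [soLeaf_eq_div, Nat.mul_div_cancel_left n two_pos, hangle]
  obtain ⟨k, rfl | rfl⟩ := Nat.even_or_odd' j
  · rw [if_neg (by simp), show ((2 * k : ℕ) : ℝ) * (π / 2) = k * π by push_cast; ring,
      Real.sin_nat_mul_pi]
    simp
  · rw [if_pos (by simp), show ((2 * k + 1 : ℕ) : ℝ) * (π / 2) = π / 2 + k * π by push_cast; ring,
      Real.sin_add_nat_mul_pi, Real.sin_pi_div_two, mul_one, ← pow_mul, mul_comm k, pow_mul,
      neg_one_sq, one_pow, one_div]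

lemma suNorm_eq_mul_inv (n j : ℕ) :
    suNorm n j = n / 2 * (Real.sin (j * π / n) ^ 2)⁻¹ := by
  rw [suNorm, div_mul_eq_div_div, div_eq_mul_inv _ (_ ^ 2)]

lemma sum_suNorm_pow (h n : ℕ) :
    ∑ j ∈ Ico 1 n, suNorm n j ^ h = (n / 2 : ℝ) ^ h * cscSum h n := by
  simp only [suNorm_eq_mul_inv, mul_pow, cscSum, mul_sum]

lemma two_pow_mul_soSum_zero_two_mul {n : ℕ} (hn : 0 < n) (h : ℕ) :
    2 ^ (h + 1) * soSum h 0 (2 * n) =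
      ∑ j ∈ Ico 1 (2 * n), suNorm (2 * n) j ^ h + (2 ^ (h + 1) - 1) * n ^ h := by
  simpa using two_pow_mul_soSum_two_mul hn (h + 1) 0

lemma two_pow_mul_soSum_succ_two_mul {n : ℕ} (hn : 0 < n) (g l : ℕ) :
    2 ^ g * soSum (g - 1) (l + 1) (2 * n) =
      n ^ (g - 1 : ℤ) * (cscSum (g + l) (2 * n) - cscSum (g + l) n +
        if Odd n then 2 ^ g - 1 else 0) := by
  rw [two_pow_mul_soSum_two_mul hn, cscSum_two_mul, add_sub_cancel_left, mul_add, mul_sum,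
    sum_filter, soLeaf_two_mul _ _ hn.ne', mul_pi_div_two_mul_self hn.ne', Real.sin_pi_div_two]
  congr 1
  · refine sum_congr rfl fun j hj => ?_
    obtain ⟨hj, hjn⟩ := mem_Ico.1 hj
    have hcsc := inv_ne_zero (pow_ne_zero 2 (sin_nat_mul_pi_div_pos hj hjn).ne')
    rw [soLeaf_two_mul _ _ hn.ne', suNorm_eq_mul_inv, mul_zpow]
    split_ifs
    · have hpow : g - 1 + ((l + 1 : ℕ) : ℤ) = (g + l : ℕ) := by push_cast; ring
      rw [mul_assoc, ← zpow_natCast (_ ^ 2)⁻¹ (l + 1), ← zpow_add₀ hcsc, hpow, zpow_natCast,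
        Nat.cast_mul, Nat.cast_two, mul_div_cancel_left₀ _ two_ne_zero]
    · simp
  · split_ifs <;> simp [mul_comm]

lemma sin_add_mul_pi_div {n : ℕ} (hn : n ≠ 0) (a j : ℕ) :
    Real.sin (a * ((j + n : ℕ) * π / n)) ^ 2 = Real.sin (a * (j * π / n)) ^ 2 := by
  have hangle : (a : ℝ) * ((j + n : ℕ) * π / n) = a * (j * π / n) + a * π := by
    push_cast
    field_simp
  rw [hangle, Real.sin_add_nat_mul_pi, mul_pow, ← pow_mul, mul_comm a, pow_mul, neg_one_sq, one_pow,
    one_mul]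

lemma suNorm_periodic {n : ℕ} (hn : n ≠ 0) : (suNorm n).Periodic n := fun j => by
  have h := sin_add_mul_pi_div hn 1 j
  rw [Nat.cast_one, one_mul, one_mul] at h
  rw [suNorm, suNorm, h]

lemma soLeaf_periodic {n : ℕ} (hn : n ≠ 0) : (soLeaf n).Periodic n := fun j => by
  have h := sin_add_mul_pi_div hn 1 j
  rw [Nat.cast_one, one_mul, one_mul] at h
  rw [soLeaf_eq_div, soLeaf_eq_div, sin_add_mul_pi_div hn, h]

lemma suNorm_two_mul (n k : ℕ) : suNorm n (2 * k) =
    n / 8 * ((Real.sin (k * π / n) ^ 2)⁻¹ * (Real.cos (k * π / n) ^ 2)⁻¹) := by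
  rw [suNorm, show ((2 * k : ℕ) : ℝ) * π / n = 2 * (k * π / n) by push_cast; ring,
    Real.sin_two_mul]
  ring

lemma soLeaf_two_mul_of_odd {n : ℕ} (hn : Odd n) {k : ℕ} (hk : 0 < k) (hkn : k < n) :
    soLeaf n (2 * k) = 1 / 4 * (Real.cos (k * π / n) ^ 2)⁻¹ := by
  have hn0 : (n : ℝ) ≠ 0 := Nat.cast_ne_zero.2 hn.pos.ne'
  have hhalf : ((n / 2 : ℕ) : ℝ) = (n - 1) / 2 := by
    obtain ⟨m, rfl⟩ := hn
    rw [show (2 * m + 1) / 2 = m by omega]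
    push_cast
    ring
  have hsin := (sin_nat_mul_pi_div_pos hk hkn).ne'
  rw [soLeaf_eq_div, hhalf, show ((2 * k : ℕ) : ℝ) * π / n = 2 * (k * π / n) by push_cast; ring,
    show (n - 1) / 2 * (2 * (k * π / n)) = k * π - k * π / n by field_simp,
    Real.sin_nat_mul_pi_sub, Real.sin_two_mul, neg_sq, mul_pow, ← pow_mul, mul_comm k, pow_mul,
    neg_one_sq, one_pow, one_mul]
  have hcos := cos_nat_mul_pi_div_ne_zero hn hk hkn
  field_simp
  norm_num

lemma two_pow_mul_soSum_of_odd_eq_sum_sec {n : ℕ} (hn : Odd n) (g l : ℕ) :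
    2 ^ g * soSum (g - 1) l n = (n / 8 : ℝ) ^ (g - 1 : ℤ) * (1 / 4) ^ l *
      ∑ k ∈ Ico 1 n, ((Real.sin (k * π / n) ^ 2)⁻¹ * (Real.cos (k * π / n) ^ 2)⁻¹) ^ (g - 1 : ℤ) *
        ((Real.cos (k * π / n) ^ 2)⁻¹) ^ l := by
  rw [two_pow_mul_soSum_of_odd hn, ← sum_Ico_one_two_mul_of_periodic hn fun j => by
    rw [suNorm_periodic hn.pos.ne', soLeaf_periodic hn.pos.ne'], mul_sum]
  refine sum_congr rfl fun k hk => ?_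
  obtain ⟨hk, hkn⟩ := mem_Ico.1 hk
  rw [suNorm_two_mul, soLeaf_two_mul_of_odd hn hk hkn, mul_zpow, mul_pow]
  ring

lemma two_pow_mul_soSum_natCast_of_odd {n : ℕ} (hn : Odd n) (h l : ℕ) :
    2 ^ (h + 1) * soSum h l n = (n / 8 : ℝ) ^ h * (1 / 4) ^ l * cscSecSum h (h + l) n := by
  have hsum := two_pow_mul_soSum_of_odd_eq_sum_sec hn (h + 1) l
  simp only [Nat.cast_add_one, add_sub_cancel_right, zpow_natCast] at hsum
  rw [hsum, cscSecSum]
  simp only [mul_pow, pow_add, mul_assoc]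

/-- Here `sin² / cos² = 1 / cos² - 1`. -/
lemma soSum_neg_one_of_odd {n : ℕ} (hn : Odd n) (l : ℕ) : soSum (-1) (l + 2) n =
    8 / n * (1 / 4) ^ (l + 2) * (cscSecSum 0 (l + 1) n - cscSecSum 0 l n) := by
  have hsum := two_pow_mul_soSum_of_odd_eq_sum_sec hn 0 (l + 2)
  simp only [pow_zero, one_mul, Nat.cast_zero, zero_sub, zpow_neg_one, inv_div] at hsum
  rw [hsum, cscSecSum, cscSecSum, ← sum_sub_distrib]
  congr 1
  refine sum_congr rfl fun k hk => ?_
  obtain ⟨hk, hkn⟩ := mem_Ico.1 hk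
  have hsec := mul_inv_cancel₀ (pow_ne_zero 2 (cos_nat_mul_pi_div_ne_zero hn hk hkn))
  rw [mul_inv, inv_inv, inv_inv, Real.sin_sq]
  set c := Real.cos (k * π / n) ^ 2
  linear_combination c⁻¹ ^ l * (c⁻¹ - c * c⁻¹ - 1) * hsec

end StateSums

section Constituents

open Polynomial

lemma eval_comp_X_add_two (P : ℝ[X]) (t : ℕ) :
    (P.comp (X + 2)).eval (t : ℝ) = P.eval ((t + 2 : ℕ) : ℝ) := by simp

lemma exists_polynomial_sum_suNorm_pow (h : ℕ) :
    ∃ P : ℝ[X], ∀ n : ℕ, 0 < n → ∑ j ∈ Ico 1 n, suNorm n j ^ h = P.eval (n : ℝ) := by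
  obtain ⟨S, hS⟩ := exists_polynomial_cscSum h
  refine ⟨(C (1 / 2) * X) ^ h * S, fun n hn => ?_⟩
  rw [sum_suNorm_pow, hS n hn]
  simp [div_eq_inv_mul]

lemma exists_polynomial_soSum_odd (h l : ℕ) :
    ∃ P : ℝ[X], ∀ n : ℕ, Odd n → soSum h l n = P.eval (n : ℝ) := by
  obtain ⟨S, hS⟩ := exists_polynomial_cscSecSum h (h + l)
  refine ⟨C (1 / 2 ^ (h + 1) * (1 / 4) ^ l) * (C (1 / 8) * X) ^ h * S, fun n hn => ?_⟩
  have hsum := two_pow_mul_soSum_natCast_of_odd hn h l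
  rw [hS n hn] at hsum
  simp only [eval_mul, eval_pow, eval_C, eval_X]
  field_simp at hsum ⊢
  linear_combination hsum

/-- The two power sums agree at `n = 0`, which absorbs the division by `n`. -/
lemma exists_polynomial_soSum_neg_one_odd (l : ℕ) :
    ∃ P : ℝ[X], ∀ n : ℕ, Odd n → soSum (-1) (l + 2) n = P.eval (n : ℝ) := by
  obtain ⟨S, hS⟩ := exists_polynomial_cscSum l
  obtain ⟨T, hT⟩ := exists_polynomial_cscSum (l + 1)
  obtain ⟨Q, hQ⟩ : X ∣ (T.comp (2 * X) - T) - (S.comp (2 * X) - S) := by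
    simp [X_dvd_iff, coeff_zero_eq_eval_zero]
  refine ⟨C (8 * (1 / 4) ^ (l + 2)) * Q, fun n hn => ?_⟩
  have hn0 : (n : ℝ) ≠ 0 := Nat.cast_ne_zero.2 hn.pos.ne'
  have hdiff := congrArg (eval (n : ℝ)) hQ
  simp only [eval_sub, eval_comp, eval_mul, eval_X, eval_ofNat] at hdiff
  have h2n : 0 < 2 * n := by have := hn.pos; omega
  rw [soSum_neg_one_of_odd hn, cscSecSum_zero_left hn, cscSecSum_zero_left hn, hS _ h2n,
    hS _ hn.pos, hT _ h2n, hT _ hn.pos, eval_mul, eval_C]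
  rw [← Nat.cast_two, ← Nat.cast_mul] at hdiff
  field_simp
  linear_combination hdiff

lemma exists_polynomial_soSum_neg_one_even (l : ℕ) :
    ∃ P : ℝ[X], ∀ n : ℕ, 0 < n → soSum (-1) (l + 1) (2 * n) = P.eval ((2 * n : ℕ) : ℝ) := by
  obtain ⟨S, hS⟩ := exists_polynomial_cscSum l
  obtain ⟨Q, hQ⟩ : X ∣ S - S.comp (C (1 / 2) * X) := by
    simp [X_dvd_iff, coeff_zero_eq_eval_zero]
  refine ⟨2 * Q, fun n hn => ?_⟩
  have hn0 : (n : ℝ) ≠ 0 := Nat.cast_ne_zero.2 hn.ne'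
  have hdiff := congrArg (eval ((2 * n : ℕ) : ℝ)) hQ
  have hsum := two_pow_mul_soSum_succ_two_mul hn 0 l
  rw [zero_add, hS _ (by omega), hS _ hn] at hsum
  simp only [eval_sub, eval_comp, eval_mul, eval_C, eval_X] at hdiff
  rw [show 1 / 2 * ((2 * n : ℕ) : ℝ) = n by push_cast; ring] at hdiff
  simp only [pow_zero, one_mul, sub_self, ite_self, add_zero, hdiff, Nat.cast_zero,
    zero_sub, zpow_neg_one] at hsum
  rw [hsum, eval_mul, eval_ofNat]
  push_cast
  field_simp

lemma exists_polynomial_soSum_even (h l : ℕ) : ∃ P₀ P₁ : ℝ[X], P₀ ≠ P₁ ∧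
    (∀ n : ℕ, 0 < n → Even n → soSum h (l + 1) (2 * n) = P₀.eval ((2 * n : ℕ) : ℝ)) ∧
    ∀ n : ℕ, Odd n → soSum h (l + 1) (2 * n) = P₁.eval ((2 * n : ℕ) : ℝ) := by
  obtain ⟨S, hS⟩ := exists_polynomial_cscSum (h + 1 + l)
  set P₀ := C (1 / 2 ^ (h + 1)) * (C (1 / 2) * X) ^ h * (S - S.comp (C (1 / 2) * X)) with hP₀
  set D : ℝ[X] := C (1 / 2 ^ (h + 1) * (2 ^ (h + 1) - 1)) * (C (1 / 2) * X) ^ h with hD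
  have hpow : (2 : ℝ) ^ (h + 1) - 1 ≠ 0 := (sub_pos.2 (one_lt_pow₀ one_lt_two h.succ_ne_zero)).ne'
  have hD0 : D ≠ 0 := by
    refine mul_ne_zero (C_ne_zero.2 (mul_ne_zero (by positivity) hpow)) (pow_ne_zero _ ?_)
    exact mul_ne_zero (C_ne_zero.2 (by norm_num)) X_ne_zero
  have hsum (n : ℕ) (hn : 0 < n) : soSum h (l + 1) (2 * n) =
      P₀.eval ((2 * n : ℕ) : ℝ) + if Odd n then D.eval ((2 * n : ℕ) : ℝ) else 0 := by
    have := two_pow_mul_soSum_succ_two_mul hn (h + 1) l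
    rw [hS _ (by omega), hS _ hn, Nat.cast_add_one, add_sub_cancel_right, zpow_natCast] at this
    have hhalf : 1 / 2 * ((2 * n : ℕ) : ℝ) = n := by push_cast; ring
    simp only [hP₀, hD, eval_mul, eval_pow, eval_sub, eval_comp, eval_C, eval_X, hhalf]
    split_ifs at this ⊢ <;> field_simp <;> linear_combination this
  refine ⟨P₀, P₀ + D, fun h => hD0 (left_eq_add.1 h), fun n hn hn' => ?_, fun n hn => ?_⟩
  · rw [hsum n hn, if_neg (Nat.not_odd_iff_even.2 hn'), add_zero]
  · rw [hsum n hn.pos, if_pos hn, eval_add]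

end Constituents

/-! ### Periods -/

section Periods

open Polynomial

lemma isConstituents_two {f : ℕ → ℕ} {p q : ℝ[X]}
    (hp : ∀ t : ℕ, Even t → (f t : ℝ) = p.eval (t : ℝ))
    (hq : ∀ t : ℕ, Odd t → (f t : ℝ) = q.eval (t : ℝ)) : IsConstituents f ![p, q] := by
  intro t i hi
  fin_cases i
  · exact hp t (Nat.even_iff.2 hi)
  · exact hq t (Nat.odd_iff.2 hi)

lemma isConstituents_four {f : ℕ → ℕ} {p₀ p₂ q : ℝ[X]}
    (hp₀ : ∀ t : ℕ, t % 4 = 0 → (f t : ℝ) = p₀.eval (t : ℝ))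
    (hp₂ : ∀ t : ℕ, t % 4 = 2 → (f t : ℝ) = p₂.eval (t : ℝ))
    (hq : ∀ t : ℕ, Odd t → (f t : ℝ) = q.eval (t : ℝ)) :
    IsConstituents f ![p₀, q, p₂, q] := by
  intro t i hi
  fin_cases i
  · exact hp₀ t hi
  · exact hq t (Nat.odd_iff.2 (Nat.odd_of_mod_four_eq_one hi))
  · exact hp₂ t hi
  · exact hq t (Nat.odd_iff.2 (Nat.odd_of_mod_four_eq_three hi))

lemma exists_hasPeriod_le_of_isConstituents {f : ℕ → ℕ} {n : ℕ} (hn : 0 < n) {p : Fin n → ℝ[X]}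
    (hp : IsConstituents f p) : ∃ m ≤ n, HasPeriod f m :=
  have hmem : n ∈ {m : ℕ | 0 < m ∧ ∃ p : Fin m → ℝ[X], IsConstituents f p} := ⟨hn, p, hp⟩
  ⟨_, Nat.sInf_le hmem, Nat.sInf_mem ⟨n, hmem⟩, fun _ hm => Nat.sInf_le hm⟩

lemma eq_of_forall_eval_mul_add_eq {p q : ℝ[X]} {a b : ℕ} (ha : 0 < a)
    (h : ∀ k : ℕ, p.eval ((a * k + b : ℕ) : ℝ) = q.eval ((a * k + b : ℕ) : ℝ)) : p = q := by
  refine eq_of_infinite_eval_eq p q ((Set.infinite_range_of_injective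
    (f := fun k : ℕ => ((a * k + b : ℕ) : ℝ)) fun k l hkl => ?_).mono ?_)
  · exact Nat.eq_of_mul_eq_mul_left ha (Nat.add_right_cancel (Nat.cast_injective hkl))
  · rintro _ ⟨k, rfl⟩
    exact h k

/-- A smaller number `m` of constituents would divide `6`, which identifies the residue classes of
`0` and `6` modulo `12`. -/
lemma hasPeriod_four {f : ℕ → ℕ} {p₀ p₂ q : ℝ[X]} (hne : p₀ ≠ p₂)
    (hp₀ : ∀ t : ℕ, t % 4 = 0 → (f t : ℝ) = p₀.eval (t : ℝ))
    (hp₂ : ∀ t : ℕ, t % 4 = 2 → (f t : ℝ) = p₂.eval (t : ℝ))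
    (hq : ∀ t : ℕ, Odd t → (f t : ℝ) = q.eval (t : ℝ)) : HasPeriod f 4 := by
  refine ⟨⟨by norm_num, _, isConstituents_four hp₀ hp₂ hq⟩, ?_⟩
  rintro m ⟨hm, r, hr⟩
  by_contra! hm4
  have hm6 : m ∣ 6 := by interval_cases m <;> norm_num
  have hp₀r : p₀ = r ⟨0, hm⟩ := eq_of_forall_eval_mul_add_eq (a := 12) (b := 0) (by norm_num)
    fun k => (hp₀ _ (by omega)).symm.trans (hr _ _ (Nat.mod_eq_zero_of_dvd (by
      exact (hm6.trans (by norm_num)).mul_right k)))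
  have hp₂r : p₂ = r ⟨0, hm⟩ := eq_of_forall_eval_mul_add_eq (a := 12) (b := 6) (by norm_num)
    fun k => (hp₂ _ (by omega)).symm.trans (hr _ _ (Nat.mod_eq_zero_of_dvd
      (((hm6.trans (by norm_num)).mul_right k).add hm6)))
  exact hne (hp₀r.trans hp₂r.symm)

end Periods

/-! ### Ehrhart quasi-polynomials -/

section OneThreeGraphs

open Polynomial

variable {α β : Type*} {G : Graph α β} (hV : V(G).Finite) (hE : E(G).Finite) (h13 : G.IsOneThree)
  (hconn : G.IsConnected)

include hV hE h13

include hconn in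
theorem ehrhart_polytopeP_eq_soSum (t : ℕ) : (ehrhart G.polytopeP t : ℝ) =
    soSum ((E(G).ncard : ℤ) - V(G).ncard) (leaves G).ncard (t + 2) := by
  have := hE.to_subtype
  have hhalf : (t + 2) / 2 = t / 2 + 1 := by omega
  have hleaf (j : Fin (t / 2 + 1)) : (soFusionRule t).leafWeight j = soLeaf (t + 2) (j + 1) := by
    rw [soLeaf, hhalf]
    exact Fin.sum_univ_eq_sum_range (fun a => sinChar (2 * a + 1) _) _
  rw [ehrhart_polytopeP h13, ncard_labelings hV hE h13 hconn, soSum, hhalf,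
    ← sum_fin_succ_eq_sum_Ico]
  simp only [hleaf]
  rfl

lemma exists_hasPeriod_le_two_of_isTree (htree : G.IsTree) :
    ∃ n ≤ 2, HasPeriod (ehrhart G.polytopeP) n := by
  have hcount := ncard_edgeSet_add_one_of_isTree hV hE htree
  have hint := ncard_internalNodes_add_ncard_leaves hV h13
  have hhandshake := three_mul_ncard_internalNodes_add_ncard_leaves hV hE h13
  obtain ⟨l, hl⟩ : ∃ l, (leaves G).ncard = l + 2 := ⟨G.internalNodes.ncard, by omega⟩
  obtain ⟨P, hP⟩ := exists_polynomial_soSum_neg_one_even (l + 1)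
  obtain ⟨Q, hQ⟩ := exists_polynomial_soSum_neg_one_odd l
  have hsum (t : ℕ) : (ehrhart G.polytopeP t : ℝ) = soSum (-1) (l + 2) (t + 2) := by
    rw [ehrhart_polytopeP_eq_soSum hV hE h13 htree.1, hl,
      show (E(G).ncard : ℤ) - V(G).ncard = -1 by omega]
  refine exists_hasPeriod_le_of_isConstituents two_pos
    (isConstituents_two (p := P.comp (X + 2)) (q := Q.comp (X + 2)) (fun t ht => ?_) fun t ht => ?_)
  · obtain ⟨m, hm⟩ := (even_iff_two_dvd.1 ht : 2 ∣ t)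
    rw [hsum, eval_comp_X_add_two, show t + 2 = 2 * (m + 1) by omega, ← hP _ m.succ_pos]
  · rw [hsum, eval_comp_X_add_two, ← hQ _ (ht.add_even even_two)]

include hconn in
lemma hasPeriod_four_of_not_isTree_of_not_isCubic (htree : ¬G.IsTree) (hcubic : ¬G.IsCubic) :
    HasPeriod (ehrhart G.polytopeP) 4 := by
  have hcount := ncard_vertexSet_le_of_not_isAcyclic hE hconn fun h => htree ⟨hconn, h⟩
  obtain ⟨l, hl⟩ : ∃ l, (leaves G).ncard = l + 1 := by
    simp only [Graph.IsCubic, not_forall] at hcubic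
    obtain ⟨v, hv, hdeg⟩ := hcubic
    exact Nat.exists_eq_succ_of_ne_zero
      (Set.ncard_ne_zero_of_mem ⟨hv, (h13 v hv).resolve_right hdeg⟩ (hV.subset (leaves_subset G)))
  obtain ⟨h, hh⟩ := Nat.exists_eq_add_of_le hcount
  obtain ⟨P₀, P₁, hne, hP₀, hP₁⟩ := exists_polynomial_soSum_even h l
  obtain ⟨Q, hQ⟩ := exists_polynomial_soSum_odd h (l + 1)
  have hsum (t : ℕ) : (ehrhart G.polytopeP t : ℝ) = soSum h (l + 1) (t + 2) := by
    rw [ehrhart_polytopeP_eq_soSum hV hE h13 hconn, hl,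
      show (E(G).ncard : ℤ) - V(G).ncard = h by omega]
  have hne' : P₁.comp (X + 2) ≠ P₀.comp (X + 2) := fun heq => hne <|
    Polynomial.funext fun x => by simpa using (congrArg (eval (x - 2)) heq).symm
  refine hasPeriod_four hne' (q := Q.comp (X + 2)) (fun t ht => ?_) (fun t ht => ?_) fun t ht => ?_
  · obtain ⟨m, rfl⟩ := Nat.dvd_of_mod_eq_zero ht
    rw [hsum, eval_comp_X_add_two, show 4 * m + 2 = 2 * (2 * m + 1) by omega, ← hP₁ _ ⟨m, rfl⟩]
  · obtain ⟨m, hm⟩ : ∃ m, t + 2 = 2 * (2 * (m + 1)) := ⟨t / 4, by omega⟩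
    rw [hsum, eval_comp_X_add_two, hm, ← hP₀ _ (by omega) (even_two_mul _)]
  · rw [hsum, eval_comp_X_add_two, ← hQ _ (ht.add_even even_two)]

end OneThreeGraphs

section CubicGraphs

open Polynomial

variable {α β : Type*} {G : Graph α β}

lemma leaves_eq_empty_of_isCubic (hcubic : G.IsCubic) : leaves G = ∅ :=
  Set.eq_empty_of_forall_notMem fun v hv => by have := hcubic v hv.1; have := hv.2; omega

lemma ncard_vertexSet_add_cyclomaticNumber_sub_one (hV : V(G).Finite) (hE : E(G).Finite)
    (hcubic : G.IsCubic) : V(G).ncard + (G.cyclomaticNumber - 1) = E(G).ncard := by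
  have h13 : G.IsOneThree := fun v hv => .inr (hcubic v hv)
  have hint := ncard_internalNodes_add_ncard_leaves hV h13
  have hhandshake := three_mul_ncard_internalNodes_add_ncard_leaves hV hE h13
  rw [leaves_eq_empty_of_isCubic hcubic, Set.ncard_empty] at hint hhandshake
  rw [Graph.cyclomaticNumber]
  omega

variable (hV : V(G).Finite) (hE : E(G).Finite) (hconn : G.IsConnected) (hcubic : G.IsCubic)

include hV hE hconn hcubic

lemma ncard_labelings_of_isCubic {A J : Type*} [Fintype A] [Fintype J] (R : FusionRule A J) :
    ((labelings G R.rule).ncard : ℝ) = ∑ j, R.norm j ^ (G.cyclomaticNumber - 1) := by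
  have hcount := ncard_vertexSet_add_cyclomaticNumber_sub_one hV hE hcubic
  rw [ncard_labelings hV hE (fun v hv => .inr (hcubic v hv)) hconn,
    leaves_eq_empty_of_isCubic hcubic,
    show (E(G).ncard : ℤ) - V(G).ncard = (G.cyclomaticNumber - 1 : ℕ) by omega]
  simp only [Set.ncard_empty, pow_zero, mul_one, zpow_natCast]

lemma numInternallyEulerian_of_isCubic :
    (G.numInternallyEulerian : ℝ) = 2 ^ (G.cyclomaticNumber - 1 + 1) := by
  have := hE.to_subtype
  rw [numInternallyEulerian_eq_ncard_labelings, ncard_labelings_of_isCubic hV hE hconn hcubic]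
  simp [parityFusionRule, pow_succ']

lemma ehrhart_polytopeQ_of_isCubic (t : ℕ) : (ehrhart G.polytopeQ t : ℝ) =
    ∑ j ∈ Ico 1 (t + 2), suNorm (t + 2) j ^ (G.cyclomaticNumber - 1) := by
  have := hE.to_subtype
  rw [ehrhart_polytopeQ fun v hv => .inr (hcubic v hv),
    ncard_labelings_of_isCubic hV hE hconn hcubic, ← sum_fin_succ_eq_sum_Ico]
  rfl

lemma ehrhart_polytopeP_of_isCubic (t : ℕ) :
    (ehrhart G.polytopeP t : ℝ) = soSum (G.cyclomaticNumber - 1 : ℕ) 0 (t + 2) := by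
  have hcount := ncard_vertexSet_add_cyclomaticNumber_sub_one hV hE hcubic
  rw [ehrhart_polytopeP_eq_soSum hV hE (fun v hv => .inr (hcubic v hv)) hconn,
    leaves_eq_empty_of_isCubic hcubic, Set.ncard_empty,
    show (E(G).ncard : ℤ) - V(G).ncard = (G.cyclomaticNumber - 1 : ℕ) by omega]

lemma numInternallyEulerian_mul_ehrhart_polytopeP {t : ℕ} (ht : Even t) :
    (G.numInternallyEulerian : ℝ) * ehrhart G.polytopeP t = ehrhart G.polytopeQ t +
      (G.numInternallyEulerian - 1) * (t / 2 + 1) ^ (G.cyclomaticNumber - 1) := by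
  obtain ⟨m, hm⟩ := (even_iff_two_dvd.1 ht : 2 ∣ t)
  rw [numInternallyEulerian_of_isCubic hV hE hconn hcubic,
    ehrhart_polytopeP_of_isCubic hV hE hconn hcubic,
    ehrhart_polytopeQ_of_isCubic hV hE hconn hcubic,
    show t + 2 = 2 * (m + 1) by omega, two_pow_mul_soSum_zero_two_mul m.succ_pos, hm]
  push_cast
  rw [mul_div_cancel_left₀ _ (two_ne_zero' ℝ)]

theorem exists_polynomials_of_isCubic : ∃ p₀ p₁ q : ℝ[X],
    (∀ t : ℕ, Even t → (ehrhart G.polytopeP t : ℝ) = p₀.eval (t : ℝ)) ∧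
    (∀ t : ℕ, Odd t → (ehrhart G.polytopeP t : ℝ) = p₁.eval (t : ℝ)) ∧
    (∀ t : ℕ, (ehrhart G.polytopeQ t : ℝ) = q.eval (t : ℝ)) ∧
    ∀ x : ℝ, q.eval x = G.numInternallyEulerian * p₀.eval x -
      (G.numInternallyEulerian - 1) * (x / 2 + 1) ^ (G.cyclomaticNumber - 1) := by
  set N : ℝ := (G.numInternallyEulerian : ℝ) with hN
  set h := G.cyclomaticNumber - 1
  have hN0 : N ≠ 0 := by
    rw [hN, numInternallyEulerian_of_isCubic hV hE hconn hcubic]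
    positivity
  obtain ⟨Q, hQ⟩ := exists_polynomial_sum_suNorm_pow h
  obtain ⟨P₁, hP₁⟩ := exists_polynomial_soSum_odd h 0
  set q := Q.comp (X + 2)
  set p₀ := C N⁻¹ * (q + C (N - 1) * (C (1 / 2) * X + 1) ^ h) with hp₀
  have hq (t : ℕ) : (ehrhart G.polytopeQ t : ℝ) = q.eval (t : ℝ) := by
    rw [ehrhart_polytopeQ_of_isCubic hV hE hconn hcubic, hQ _ (by omega), eval_comp_X_add_two]
  have hp₀q (x : ℝ) : N * p₀.eval x = q.eval x + (N - 1) * (x / 2 + 1) ^ h := by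
    simp only [hp₀, eval_mul, eval_add, eval_pow, eval_C, eval_X, eval_one]
    rw [mul_inv_cancel_left₀ hN0, one_div_mul_eq_div]
  refine ⟨p₀, P₁.comp (X + 2), q, fun t ht => mul_left_cancel₀ hN0 ?_, fun t ht => ?_, hq,
    fun x => eq_sub_of_add_eq (hp₀q x).symm⟩
  · rw [hp₀q, ← hq, numInternallyEulerian_mul_ehrhart_polytopeP hV hE hconn hcubic ht]
  · rw [ehrhart_polytopeP_of_isCubic hV hE hconn hcubic, eval_comp_X_add_two,
      hP₁ _ (ht.add_even even_two)]

end CubicGraphs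

end LiuOsserman

theorem mainTheorem1 {α β : Type*} (G : Graph α β)
    (hV : G.vertexSet.Finite) (hE : G.edgeSet.Finite)
    (h13 : G.IsOneThree) (hconn : G.IsConnected) :
    (G.IsTree ∨ G.IsCubic → ∃ n ≤ 2, HasPeriod (ehrhart G.polytopeP) n) ∧
    (¬ (G.IsTree ∨ G.IsCubic) → HasPeriod (ehrhart G.polytopeP) 4) ∧
    (G.IsCubic →
      ∃ (p : Fin 4 → Polynomial ℝ) (q : Fin 2 → Polynomial ℝ),
        IsConstituents (ehrhart G.polytopeP) p ∧
        IsConstituents (ehrhart G.polytopeQ) q ∧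
        ∀ t : ℝ,
          (q 0).eval t = G.numInternallyEulerian * (p 0).eval t -
            (G.numInternallyEulerian - 1) * (t / 2 + 1) ^ (G.cyclomaticNumber - 1) ∧
          (q 0).eval t = G.numInternallyEulerian * (p 2).eval t -
            (G.numInternallyEulerian - 1) * (t / 2 + 1) ^ (G.cyclomaticNumber - 1)) := by
  open LiuOsserman in
  refine ⟨?_, fun h => ?_, fun hcubic => ?_⟩
  · rintro (htree | hcubic)
    · exact exists_hasPeriod_le_two_of_isTree hV hE h13 htree
    · obtain ⟨p₀, p₁, -, hp₀, hp₁, -⟩ := exists_polynomials_of_isCubic hV hE hconn hcubic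
      exact exists_hasPeriod_le_of_isConstituents two_pos (isConstituents_two hp₀ hp₁)
  · obtain ⟨htree, hcubic⟩ := not_or.1 h
    exact hasPeriod_four_of_not_isTree_of_not_isCubic hV hE h13 hconn htree hcubic
  · obtain ⟨p₀, p₁, q, hp₀, hp₁, hq, hpq⟩ := exists_polynomials_of_isCubic hV hE hconn hcubic
    exact ⟨![p₀, p₁, p₀, p₁], ![q, q],
      isConstituents_four (fun t ht => hp₀ t (Nat.even_iff.2 (by omega)))
        (fun t ht => hp₀ t (Nat.even_iff.2 (by omega))) hp₁,
      isConstituents_two (fun t _ => hq t) fun t _ => hq t, fun t => ⟨hpq t, hpq t⟩⟩
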